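/- Let $p$ be an odd prime, let $q$ be a power of $p$ of the form $q=2^ab+1$ with $a\ge 2$ and $b$ odd, and let $r,s\ge 1$. Let $\beta$ be a primitive $2^r$-th root of unity in an extension field of $\mathbb{F}_q$ and, for $h\in\mathbb{Z}$, let $m_h(x)$ be the minimal polynomial of $\beta^h$ over $\mathbb{F}_q$. For $2\le i\le r$ put $D_i=\{\pm 1,\pm 3,\pm 3^2,\dots,\pm 3^{2^{i-2}-1}\}$ if $i\le a$ and $D_i=\{\pm 1,\pm 3,\dots,\pm 3^{2^{a-2}-1}\}$ if $i\ge a+1$. Let $$C=\Big\langle m_0(x)^{j_0}\,m_{2^{r-1}}(x)^{j_{2^{r-1}}}\prod_{i=2}^{r}\prod_{t\in D_i}m_{t2^{r-i}}(x)^{j_{t2^{r-i}}}\Big\rangle$$ be a cyclic code of length $n=2^rp^s$ over $\mathbb{F}_q$ (an ideal of $\mathbb{F}_q[x]/(x^n-1)$), where the non-negative integer exponents satisfy $j_0,\,j_{2^{r-1}}<\frac{p^s}{2}$ and $j_{t2^{r-i}}+j_{-t2^{r-i}}\le p^s$ for all $t\in D_i$, $2\le i\le r$. Let $d_H(C)$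 be its Hamming distance and $C^\perp$ its Euclidean dual. A quantum error-correcting (QEC) code of length $n$ is a subspace of $(\mathbb{C}^q)^{\otimes n}$, which has the orthonormal basis $|x\rangle$, $x\in\mathbb{F}_q^n$. Its minimum distance is the least weight of an error operator $X_uZ_v$ ($X_u|x\rangle=|x+u\rangle$, $Z_v|x\rangle=e^{2\pi i\,\mathrm{Tr}(x\cdot v)/p}|x\rangle$, $u,v\in\mathbb{F}_q^n$) that it does not detect, where $Q$ detects $E$ if there is a scalar $c$ with $\langle\psi|E|\varphi\rangle=c\langle\psi|\varphi\rangle$ for all $\psi,\varphi\in Q$. An $[[n,k,d]]_q$ QEC code is one of complex dimension $q^k$ whose minimum distance is at least $d$. The CSS code of a linear code $C$ with $C^\perp\subseteq C$ is the span of the states $\sum_{y\in C^\perp}|x+y\rangle$, $x\in C$. Then $C^\perp\subseteq C$, and the following hold. (1) If $r\le a$, then the CSS code of $C$ is a QEC code with parameters $$\Big[\Big[2^rp^s,\;2^rp^s-2j_0-2j_{2^{r-1}}-2\sum_{i=2}^{r}\sum_{t\in D_i}j_{t2^{r-i}},\;d_H(C)\Big]\Big]_q,$$ and the number of QEC codes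 that the CSS construction yields from all cyclic codes of length $2^rp^s$ over $\mathbb{F}_q$ that contain their Euclidean dual is $(p^s+2)^{2^{r-1}-1}\left(\frac{p^s+1}{2}\right)^{2^{r-1}+1}$. (2) If $r>a$, then the CSS code of $C$ is a QEC code with parameters $$\Big[\Big[2^rp^s,\;2^rp^s-2j_0-2j_{2^{r-1}}-2\sum_{i=2}^{a}\sum_{t\in D_i}j_{t2^{r-i}}-2\sum_{i=a+1}^{r}\sum_{t\in D_i}2^{i-a}j_{t2^{r-i}},\;d_H(C)\Big]\Big]_q,$$ and the number of QEC codes that the CSS construction yields from all cyclic codes of length $2^rp^s$ over $\mathbb{F}_q$ that contain their Euclidean dual is $(p^s+2)^{2^{a-1}+(r-a)2^{a-2}-1}\left(\frac{p^s+1}{2}\right)^{2^{a-1}+(r-a)2^{a-2}+1}$. In both cases the minimum distance of the CSS code equals $d_H(C)$ whenever some codeword of $C$ of weight $d_H(C)$ lies outside $C^\perp$. -/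

import Mathlib

open Polynomial

noncomputable section

namespace QuantumCyclic

/-! Classical codes -/

section Classical

variable {F : Type*} [Field F] {n : ℕ}

/-- The Euclidean dual `C^⊥` of a linear code `C ⊆ F^n`. -/
def dualCode (C : Submodule F (Fin n → F)) : Submodule F (Fin n → F) where
  carrier := {x | ∀ y ∈ C, x ⬝ᵥ y = 0}
  add_mem' := by
    intro x x' hx hx' y hy
    rw [add_dotProduct, hx y hy, hx' y hy, add_zero]
  zero_mem' := by
    intro y _
    exact zero_dotProduct y
  smul_mem' := by
    intro c x hx y hy
    rw [smul_dotProduct, hx y hy, smul_zero]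

/-- The Hamming distance `d_H(C)` of a code. -/
def minDist [DecidableEq F] (C : Submodule F (Fin n → F)) : ℕ :=
  sInf {w | ∃ x ∈ C, ∃ y ∈ C, x ≠ y ∧ hammingDist x y = w}

/-- A linear code is cyclic if the cyclic shift `(c_{n-1}, c_0, …, c_{n-2})` of every
codeword is a codeword. -/
def IsCyclicCode (C : Submodule F (Fin n → F)) : Prop :=
  ∀ c ∈ C, c ∘ (finRotate n).symm ∈ C

variable (F n) in
/-- The identification of `F^n` with `F[x]/(x^n - 1)`,
`(c_0, …, c_{n-1}) ↦ c_0 + c_1 x + ⋯ + c_{n-1} x^{n-1}`. -/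
def toQuotient : (Fin n → F) →ₗ[F] AdjoinRoot (X ^ n - 1 : F[X]) :=
  Fintype.linearCombination F
    (fun i : Fin n => AdjoinRoot.root (X ^ n - 1 : F[X]) ^ (i : ℕ))

variable (n) in
/-- The cyclic code `⟨g(x)⟩` of length `n`: the ideal of `F[x]/(x^n - 1)` generated by `g`,
read as a subspace of `F^n`. -/
def cyclicCode (g : F[X]) : Submodule F (Fin n → F) :=
  ((Ideal.span {AdjoinRoot.mk (X ^ n - 1 : F[X]) g}).restrictScalars F).comap (toQuotient F n)

end Classical

/-! The factors of `x^(2^r) - 1` when `q = 2^a b + 1` -/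

/-- The set `D_i = {±1, ±3, ±3^2, …}`, the powers of `3` having exponents below `2^(i-2)`
if `2 ≤ i ≤ a` and below `2^(a-2)` if `i ≥ a + 1`. -/
def D (a i : ℕ) : Finset ℤ :=
  let powers := (Finset.range (if i ≤ a then 2 ^ (i - 2) else 2 ^ (a - 2))).image
    (fun k : ℕ => (3 : ℤ) ^ k)
  powers ∪ powers.image (fun t => -t)

/-- The minimal polynomial `m_h(x)` of `β^h` over `F`. -/
def m (F : Type*) {K : Type*} [Field F] [Field K] [Algebra F K] (β : K) (h : ℤ) : F[X] :=
  minpoly F (β ^ h)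

/-- The polynomial
`m_0^{j_0} m_{2^{r-1}}^{j_{2^{r-1}}} ∏_{i=2}^r ∏_{t ∈ D_i} m_{t 2^{r-i}}^{j_{t 2^{r-i}}}`. -/
def generator (F : Type*) {K : Type*} [Field F] [Field K] [Algebra F K] (β : K)
    (a r : ℕ) (j : ℤ → ℕ) : F[X] :=
  m F β 0 ^ j 0 * m F β (2 ^ (r - 1)) ^ j (2 ^ (r - 1)) *
    ∏ i ∈ Finset.Icc 2 r, ∏ t ∈ D a i, m F β (t * 2 ^ (r - i)) ^ j (t * 2 ^ (r - i))

/-! Quantum codes -/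

section Quantum

/-- The state space `V_n = (ℂ^q)^{⊗ n}`, with orthonormal basis `|x⟩`, `x ∈ F^n`;
a vector is given by its coordinates in this basis. -/
abbrev StateSpace (F : Type*) [Fintype F] (n : ℕ) : Type _ := EuclideanSpace ℂ (Fin n → F)

variable {F : Type*} [Field F] [Fintype F] {n : ℕ}

/-- The operator `X_u`, `|x⟩ ↦ |x + u⟩`. -/
def opX (u : Fin n → F) : StateSpace F n →ₗ[ℂ] StateSpace F n where
  toFun ψ := WithLp.toLp 2 fun y => ψ (y - u)
  map_add' := by
    intro ψ φ
    ext y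
    rfl
  map_smul' := by
    intro c ψ
    ext y
    rfl

/-- The operator `Z_v`, `|x⟩ ↦ ζ^{Tr(x ⬝ v)} |x⟩` with `ζ = exp(2πi/p)`. -/
def opZ (p : ℕ) [Fact p.Prime] [Algebra (ZMod p) F] (v : Fin n → F) :
    StateSpace F n →ₗ[ℂ] StateSpace F n where
  toFun ψ := WithLp.toLp 2 fun y =>
    ZMod.stdAddChar (N := p) (Algebra.trace (ZMod p) F (y ⬝ᵥ v)) * ψ y
  map_add' := by
    intro ψ φ
    ext y
    exact mul_add _ _ _
  map_smul' := by
    intro c ψ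
    ext y
    exact mul_left_comm _ _ _

/-- The weight of the error operator `X_u Z_v`: the number of positions on which it does not
act as the identity. -/
def errorWeight [DecidableEq F] (u v : Fin n → F) : ℕ :=
  (Finset.univ.filter fun i => u i ≠ 0 ∨ v i ≠ 0).card

/-- The code `Q` detects the error operator `E` : `⟨ψ|E|φ⟩ = c ⟨ψ|φ⟩` on `Q`, with `c`
depending only on `E`. (A phase factor in front of `E` is irrelevant.) -/
def Detects (Q : Submodule ℂ (StateSpace F n)) (E : StateSpace F n →ₗ[ℂ] StateSpace F n) :
    Prop :=
  ∃ c : ℂ, ∀ ψ ∈ Q, ∀ φ ∈ Q, inner ℂ ψ (E φ) = c * inner ℂ ψ φ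

/-- The minimum distance of a quantum code (of dimension at least `2`): the least weight of an
error operator that it does not detect. -/
def quantumMinDist (p : ℕ) [Fact p.Prime] [Algebra (ZMod p) F] [DecidableEq F]
    (Q : Submodule ℂ (StateSpace F n)) : ℕ :=
  sInf {w | ∃ u v : Fin n → F, errorWeight u v = w ∧ ¬ Detects Q (opX u ∘ₗ opZ p v)}

/-- `Q ⊆ V_n` is an `[[n, k, d]]_q` quantum error-correcting code: its complex dimension is
`q^k` and its minimum distance is at least `d`. -/
def IsQECCode (p : ℕ) [Fact p.Prime] [Algebra (ZMod p) F] [DecidableEq F]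
    (Q : Submodule ℂ (StateSpace F n)) (k : ℤ) (d : ℕ) : Prop :=
  (Module.finrank ℂ Q : ℝ) = (Fintype.card F : ℝ) ^ k ∧ d ≤ quantumMinDist p Q

open Classical in
/-- The unnormalized coset state `∑_{y ∈ C'} |x + y⟩`. -/
def cosetState (C' : Submodule F (Fin n → F)) (x : Fin n → F) : StateSpace F n :=
  WithLp.toLp 2 fun z => if z - x ∈ C' then 1 else 0

/-- The CSS code of `C' ⊆ C`: the span of the states `∑_{y ∈ C'} |x + y⟩`, `x ∈ C`. -/
def cssCode (C C' : Submodule F (Fin n → F)) : Submodule ℂ (StateSpace F n) :=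
  Submodule.span ℂ (cosetState C' '' (C : Set (Fin n → F)))

variable (F n) in
/-- The quantum codes in `V_n` that the CSS construction with `C' = C^⊥` yields from the cyclic
codes `C` of length `n` over `F` with `C^⊥ ⊆ C`. -/
def cyclicCSSCodes : Set (Submodule ℂ (StateSpace F n)) :=
  {Q | ∃ C : Submodule F (Fin n → F), IsCyclicCode C ∧ dualCode C ≤ C ∧
    Q = cssCode C (dualCode C)}

end Quantum

end QuantumCyclic

end

noncomputable section

namespace QuantumCyclic

section Dual

variable {F : Type*} [Field F] {n : ℕ}

theorem mem_dualCode {C : Submodule F (Fin n → F)} {x : Fin n → F} :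
    x ∈ dualCode C ↔ ∀ y ∈ C, x ⬝ᵥ y = 0 := Iff.rfl

theorem dualCode_eq_orthogonal (C : Submodule F (Fin n → F)) :
    dualCode C = LinearMap.BilinForm.orthogonal (dotProductBilin F F) C := by
  ext x
  simp only [mem_dualCode, LinearMap.BilinForm.mem_orthogonal_iff]
  exact forall₂_congr fun y _ => by rw [dotProduct_comm]; rfl

theorem dotProductBilin_isRefl :
    LinearMap.BilinForm.IsRefl (dotProductBilin F F : LinearMap.BilinForm F (Fin n → F)) :=
  fun x y h => (dotProduct_comm y x).trans h

theorem dotProductBilin_nondegenerate :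
    LinearMap.BilinForm.Nondegenerate
      (dotProductBilin F F : LinearMap.BilinForm F (Fin n → F)) := by
  refine (dotProductBilin_isRefl (F := F)).nondegenerate_iff_separatingLeft.2 fun x hx => ?_
  exact dotProduct_eq_zero _ hx

theorem finrank_dualCode (C : Submodule F (Fin n → F)) :
    Module.finrank F (dualCode C) = n - Module.finrank F C := by
  rw [dualCode_eq_orthogonal,
    LinearMap.BilinForm.finrank_orthogonal dotProductBilin_nondegenerate, Module.finrank_fin_fun]

theorem dualCode_dualCode (C : Submodule F (Fin n → F)) : dualCode (dualCode C) = C := by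
  rw [dualCode_eq_orthogonal, dualCode_eq_orthogonal,
    LinearMap.BilinForm.orthogonal_orthogonal dotProductBilin_nondegenerate
      dotProductBilin_isRefl]

theorem minDist_le_hammingNorm [DecidableEq F] {C : Submodule F (Fin n → F)} {x : Fin n → F}
    (hx : x ∈ C) (h0 : x ≠ 0) : minDist C ≤ hammingNorm x :=
  Nat.sInf_le ⟨x, hx, 0, C.zero_mem, h0, hammingDist_zero_right x⟩

end Dual

section CSS

variable {F : Type*} [Field F] [Fintype F] {n : ℕ} {C C' : Submodule F (Fin n → F)}

open Classical in
theorem cosetState_apply (x z : Fin n → F) :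
    cosetState C' x z = if z - x ∈ C' then 1 else 0 := rfl

theorem cosetState_mem_cssCode {x : Fin n → F} (hx : x ∈ C) :
    cosetState C' x ∈ cssCode C C' := Submodule.subset_span ⟨x, hx, rfl⟩

theorem cosetState_apply_self (x : Fin n → F) : cosetState C' x x = 1 := by
  simp [cosetState_apply]

theorem apply_eq_zero_of_mem_cssCode (h : C' ≤ C) {ψ : StateSpace F n} (hψ : ψ ∈ cssCode C C')
    {z : Fin n → F} (hz : z ∉ C) : ψ z = 0 := by
  induction hψ using Submodule.span_induction with
  | mem ψ hψ =>
    obtain ⟨x, hx, rfl⟩ := hψ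
    rw [cosetState_apply, if_neg]
    intro h'
    exact hz (by simpa using C.add_mem (h h') hx)
  | zero => rfl
  | add ψ φ _ _ hψ hφ => simp [hψ, hφ]
  | smul c ψ _ hψ => simp [hψ]

theorem apply_add_of_mem_cssCode {ψ : StateSpace F n} (hψ : ψ ∈ cssCode C C')
    (z : Fin n → F) {y : Fin n → F} (hy : y ∈ C') : ψ (z + y) = ψ z := by
  induction hψ using Submodule.span_induction with
  | mem ψ hψ =>
    obtain ⟨x, hx, rfl⟩ := hψ
    simp only [cosetState_apply]
    congr 1
    rw [add_sub_right_comm, C'.add_mem_iff_left hy]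
  | zero => rfl
  | add ψ φ _ _ hψ hφ => simp [hψ, hφ]
  | smul c ψ _ hψ => simp [hψ]

theorem mem_iff_exists_apply_ne_zero (h : C' ≤ C) (z : Fin n → F) :
    z ∈ C ↔ ∃ ψ ∈ cssCode C C', ψ z ≠ 0 := by
  constructor
  · exact fun hz => ⟨_, cosetState_mem_cssCode hz, by simp [cosetState_apply_self]⟩
  · rintro ⟨ψ, hψ, hne⟩
    by_contra hz
    exact hne (apply_eq_zero_of_mem_cssCode h hψ hz)

theorem cssCode_dualCode_injOn :
    Set.InjOn (fun C : Submodule F (Fin n → F) => cssCode C (dualCode C))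
      {C | dualCode C ≤ C} := by
  intro C₁ h₁ C₂ h₂ h
  ext z
  simp only at h
  rw [mem_iff_exists_apply_ne_zero h₁, mem_iff_exists_apply_ne_zero h₂, h]

theorem cosetState_congr {x x' : Fin n → F} (h : x - x' ∈ C') :
    cosetState C' x = cosetState C' x' := by
  ext z
  simp only [cosetState_apply]
  congr 1
  rw [← sub_add_sub_cancel z x x', C'.add_mem_iff_left h]

theorem finrank_cssCode (h : C' ≤ C) :
    Module.finrank ℂ (cssCode C C') =
      Fintype.card F ^ (Module.finrank F C - Module.finrank F C') := by
  classical
  let v : (C ⧸ C'.submoduleOf C) → StateSpace F n := fun x => cosetState C' (x.out : C)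
  have hv : ∀ x : C, v (Submodule.Quotient.mk x) = cosetState C' x := by
    intro x
    refine cosetState_congr ?_
    have := (Submodule.Quotient.eq (C'.submoduleOf C)).1
      (Quotient.out_eq (Submodule.Quotient.mk x : C ⧸ C'.submoduleOf C))
    exact this
  have hspan : cssCode C C' = Submodule.span ℂ (Set.range v) := by
    unfold cssCode
    congr 1
    ext ψ
    constructor
    · rintro ⟨x, hx, rfl⟩
      exact ⟨Submodule.Quotient.mk ⟨x, hx⟩, hv ⟨x, hx⟩⟩
    · rintro ⟨q, rfl⟩
      exact ⟨_, (q.out : C).2, rfl⟩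
  have hli : LinearIndependent ℂ v := by
    rw [Fintype.linearIndependent_iff]
    intro g hg q
    have h1 := congrArg (fun ψ : StateSpace F n => ψ (q.out : C)) hg
    simp only [WithLp.ofLp_sum, WithLp.ofLp_smul, Finset.sum_apply, Pi.smul_apply, smul_eq_mul,
      WithLp.ofLp_zero, Pi.zero_apply] at h1
    rw [Finset.sum_eq_single q] at h1
    · simpa [v, cosetState_apply_self] using h1
    · intro q' _ hne
      rw [mul_eq_zero]
      right
      simp only [v]
      rw [cosetState_apply, if_neg]
      intro hmem
      apply hne
      rw [← Quotient.out_eq q, ← Quotient.out_eq q']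
      exact ((Submodule.Quotient.eq (C'.submoduleOf C)).2 hmem).symm
    · simp
  have : Fintype (C ⧸ C'.submoduleOf C) := Fintype.ofFinite _
  rw [hspan, finrank_span_eq_card hli, Module.card_eq_pow_finrank (K := F)]
  congr 1
  have h2 := Submodule.finrank_quotient_add_finrank (C'.submoduleOf C)
  rw [(Submodule.submoduleOfEquivOfLe h).finrank_eq] at h2
  omega

variable (p : ℕ) [Fact p.Prime] [Algebra (ZMod p) F]

theorem opX_comp_opZ_apply (u v : Fin n → F) (φ : StateSpace F n) (z : Fin n → F) :
    (opX u ∘ₗ opZ p v) φ z =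
      ZMod.stdAddChar (N := p) (Algebra.trace (ZMod p) F ((z - u) ⬝ᵥ v)) * φ (z - u) := rfl

variable {p} in
theorem exists_stdAddChar_trace_ne_one {v : Fin n → F} {D : Submodule F (Fin n → F)}
    (hv : v ∉ dualCode D) :
    ∃ y ∈ D, ZMod.stdAddChar (N := p) (Algebra.trace (ZMod p) F (y ⬝ᵥ v)) ≠ 1 := by
  simp only [mem_dualCode, not_forall] at hv
  obtain ⟨y, hy, hne⟩ := hv
  obtain ⟨c, hc⟩ : ∃ c, Algebra.trace (ZMod p) F (v ⬝ᵥ y * c) ≠ 0 := by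
    by_contra! h
    exact hne ((traceForm_nondegenerate (ZMod p) F).1 _ h)
  refine ⟨c • y, D.smul_mem c hy, fun h1 => hc ?_⟩
  rw [smul_dotProduct, smul_eq_mul, mul_comm, dotProduct_comm,
    ← AddChar.map_zero_eq_one (ZMod.stdAddChar (N := p))] at h1
  exact ZMod.injective_stdAddChar h1

theorem detects_of_not_mem_left (h : C' ≤ C) {u : Fin n → F} (hu : u ∉ C) (v : Fin n → F) :
    Detects (cssCode C C') (opX u ∘ₗ opZ p v) := by
  refine ⟨0, fun ψ hψ φ hφ => ?_⟩
  rw [zero_mul, PiLp.inner_apply]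
  refine Finset.sum_eq_zero fun z _ => ?_
  rw [opX_comp_opZ_apply]
  by_cases hz : z ∈ C
  · rw [apply_eq_zero_of_mem_cssCode h hφ (z := z - u)]
    · simp
    · intro h'
      exact hu (by simpa using C.sub_mem hz h')
  · rw [apply_eq_zero_of_mem_cssCode h hψ hz]
    simp

theorem detects_of_not_mem_right (u : Fin n → F) {v : Fin n → F} (hv : v ∉ dualCode C') :
    Detects (cssCode C C') (opX u ∘ₗ opZ p v) := by
  obtain ⟨y, hy, hne⟩ := exists_stdAddChar_trace_ne_one (p := p) hv
  refine ⟨0, fun ψ hψ φ hφ => ?_⟩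
  rw [zero_mul, PiLp.inner_apply]
  set S := ∑ z, inner ℂ (ψ z) ((opX u ∘ₗ opZ p v) φ z) with hS
  have key : S = ZMod.stdAddChar (N := p) (Algebra.trace (ZMod p) F (y ⬝ᵥ v)) * S := by
    rw [hS, Finset.mul_sum, ← Equiv.sum_comp (Equiv.addRight y)]
    refine Finset.sum_congr rfl fun z _ => ?_
    simp only [Equiv.coe_addRight, opX_comp_opZ_apply, RCLike.inner_apply]
    rw [apply_add_of_mem_cssCode hψ z hy, add_sub_right_comm,
      apply_add_of_mem_cssCode hφ _ hy, add_dotProduct, map_add, AddChar.map_add_eq_mul]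
    ring
  by_contra h0
  exact hne (mul_right_cancel₀ h0 (by rw [← key, one_mul]))

theorem detects_of_mem_dualCode (h : dualCode C ≤ C) {u v : Fin n → F} (hu : u ∈ dualCode C)
    (hv : v ∈ dualCode C) :
    Detects (cssCode C (dualCode C)) (opX u ∘ₗ opZ p v) := by
  refine ⟨1, fun ψ hψ φ hφ => ?_⟩
  suffices (opX u ∘ₗ opZ p v) φ = φ by rw [this, one_mul]
  ext z
  rw [opX_comp_opZ_apply, sub_eq_add_neg,
    apply_add_of_mem_cssCode hφ z ((dualCode C).neg_mem hu)]
  by_cases hz : z ∈ C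
  · rw [dotProduct_comm, hv _ (C.add_mem hz (C.neg_mem (h hu)))]
    simp
  · rw [apply_eq_zero_of_mem_cssCode h hφ hz, mul_zero]

theorem not_detects_opX {c : Fin n → F} (hc : c ∈ C) (hc' : c ∉ C') :
    ¬ Detects (cssCode C C') (opX c ∘ₗ opZ p 0) := by
  rintro ⟨k, hk⟩
  have hE : (opX c ∘ₗ opZ p 0) (cosetState C' 0) = cosetState C' c := by
    ext z
    rw [opX_comp_opZ_apply]
    simp only [dotProduct_zero, map_zero, AddChar.map_zero_eq_one, one_mul, cosetState_apply]
    congr 2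
    exact sub_zero _
  have h1 := hk _ (cosetState_mem_cssCode C.zero_mem) _ (cosetState_mem_cssCode C.zero_mem)
  have h2 := hk _ (cosetState_mem_cssCode hc) _ (cosetState_mem_cssCode C.zero_mem)
  rw [hE] at h1 h2
  have orth : ∀ x y, x - y ∉ C' → inner ℂ (cosetState C' x) (cosetState C' y) = (0 : ℂ) := by
    intro x y hxy
    rw [PiLp.inner_apply]
    refine Finset.sum_eq_zero fun z _ => ?_
    simp only [cosetState_apply]
    by_cases hx : z - x ∈ C'
    · rw [if_neg (c := z - y ∈ C')]
      · simp
      · intro hy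
        exact hxy (by simpa using C'.sub_mem hy hx)
    · simp [hx]
  rw [orth c 0 (by simpa using hc'), mul_zero] at h2
  rw [inner_self_eq_zero] at h2
  have := cosetState_apply_self (C' := C') c
  rw [h2] at this
  simp at this

theorem exists_mem_of_not_detects (h : dualCode C ≤ C) {u v : Fin n → F}
    (huv : ¬ Detects (cssCode C (dualCode C)) (opX u ∘ₗ opZ p v)) :
    u ∈ C ∧ v ∈ C ∧ (u ∉ dualCode C ∨ v ∉ dualCode C) := by
  refine ⟨?_, ?_, ?_⟩
  · by_contra hu
    exact huv (detects_of_not_mem_left p h hu v)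
  · by_contra hv
    rw [← dualCode_dualCode C] at hv
    exact huv (detects_of_not_mem_right p u hv)
  · by_contra! h'
    exact huv (detects_of_mem_dualCode p h h'.1 h'.2)

variable [DecidableEq F]

omit [Fintype F] in
theorem errorWeight_zero_right (u : Fin n → F) : errorWeight u 0 = hammingNorm u := by
  simp [errorWeight, hammingNorm]

theorem minDist_le_errorWeight (h : dualCode C ≤ C) {u v : Fin n → F}
    (huv : ¬ Detects (cssCode C (dualCode C)) (opX u ∘ₗ opZ p v)) :
    minDist C ≤ errorWeight u v := by
  obtain ⟨hu, hv, h'⟩ := exists_mem_of_not_detects p h huv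
  rcases h' with h' | h'
  · refine (minDist_le_hammingNorm hu ?_).trans (Finset.card_le_card fun i => ?_)
    · rintro rfl
      exact h' (zero_mem _)
    · simp +contextual
  · refine (minDist_le_hammingNorm hv ?_).trans (Finset.card_le_card fun i => ?_)
    · rintro rfl
      exact h' (zero_mem _)
    · simp +contextual

theorem minDist_le_quantumMinDist (h : dualCode C < C) :
    minDist C ≤ quantumMinDist p (cssCode C (dualCode C)) := by
  obtain ⟨c, hc, hc'⟩ := SetLike.exists_of_lt h
  refine le_csInf ⟨_, c, 0, rfl, not_detects_opX p hc hc'⟩ ?_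
  rintro w ⟨u, v, rfl, huv⟩
  exact minDist_le_errorWeight p h.le huv

theorem quantumMinDist_eq_minDist (h : dualCode C ≤ C)
    (hc : ∃ c ∈ C, c ∉ dualCode C ∧ hammingNorm c = minDist C) :
    quantumMinDist p (cssCode C (dualCode C)) = minDist C := by
  obtain ⟨c, hc, hc', hw⟩ := hc
  refine le_antisymm ?_ (minDist_le_quantumMinDist p (lt_of_le_of_ne h ?_))
  · rw [← hw, ← errorWeight_zero_right]
    exact Nat.sInf_le ⟨c, 0, rfl, not_detects_opX p hc hc'⟩
  · intro heq
    exact hc' (by rwa [heq])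

theorem isQECCode_cssCode (h : dualCode C ≤ C) (hC : n < 2 * Module.finrank F C) :
    IsQECCode p (cssCode C (dualCode C)) (2 * Module.finrank F C - n) (minDist C) := by
  have hle : Module.finrank F C ≤ n := by simpa using Submodule.finrank_le C
  have hd := finrank_dualCode C
  refine ⟨?_, minDist_le_quantumMinDist p (lt_of_le_of_ne h ?_)⟩
  · rw [finrank_cssCode h, hd, Nat.cast_pow, ← zpow_natCast]
    congr 1
    omega
  · intro heq
    rw [heq] at hd
    omega

end CSS

section CyclicCode

variable {F : Type*} [Field F] {n : ℕ}

/-- The polynomial `c_0 + c_1 x + ⋯ + c_{n-1} x^{n-1}` of a word. -/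
def toPoly (c : Fin n → F) : F[X] := ∑ i : Fin n, monomial (i : ℕ) (c i)

theorem coeff_toPoly (c : Fin n → F) (k : ℕ) :
    (toPoly c).coeff k = if h : k < n then c ⟨k, h⟩ else 0 := by
  simp only [toPoly, finsetSum_coeff, coeff_monomial]
  split_ifs with h
  · rw [Finset.sum_eq_single ⟨k, h⟩]
    · simp
    · intro i _ hne
      exact if_neg fun h' => hne (Fin.ext h')
    · simp
  · exact Finset.sum_eq_zero fun i _ => if_neg fun (h' : (i : ℕ) = k) => h (h' ▸ i.2)

theorem coeff_toPoly_fin (c : Fin n → F) (i : Fin n) : (toPoly c).coeff i = c i := by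
  simp [coeff_toPoly]

theorem degree_toPoly_lt (c : Fin n → F) : (toPoly c).degree < n := by
  rw [degree_lt_iff_coeff_zero]
  intro k hk
  rw [coeff_toPoly, dif_neg (by omega)]

theorem natDegree_toPoly_le (c : Fin n → F) : (toPoly c).natDegree ≤ n - 1 := by
  rw [natDegree_le_iff_coeff_eq_zero]
  intro k hk
  rw [coeff_toPoly, dif_neg (by omega)]

theorem toPoly_add (c d : Fin n → F) : toPoly (c + d) = toPoly c + toPoly d := by
  simp [toPoly, Finset.sum_add_distrib]

theorem toPoly_smul (k : F) (c : Fin n → F) : toPoly (k • c) = k • toPoly c := by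
  simp [toPoly, Finset.smul_sum, smul_monomial]

theorem toPoly_coeff {f : F[X]} (hf : f.degree < n) :
    toPoly (fun i : Fin n => f.coeff i) = f := by
  ext k
  rw [coeff_toPoly]
  split_ifs with h
  · rfl
  · exact (coeff_eq_zero_of_degree_lt (hf.trans_le (by exact_mod_cast not_lt.1 h))).symm

theorem toQuotient_eq_mk (c : Fin n → F) :
    toQuotient F n c = AdjoinRoot.mk (X ^ n - 1 : F[X]) (toPoly c) := by
  rw [toQuotient, Fintype.linearCombination_apply, toPoly, map_sum]
  refine Finset.sum_congr rfl fun i _ => ?_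
  rw [← C_mul_X_pow_eq_monomial, map_mul, map_pow, AdjoinRoot.mk_X, AdjoinRoot.mk_C,
    Algebra.smul_def]
  rfl

theorem mem_cyclicCode {g : F[X]} (hg : g ∣ X ^ n - 1) {c : Fin n → F} :
    c ∈ cyclicCode n g ↔ g ∣ toPoly c := by
  rw [cyclicCode, Submodule.mem_comap, Submodule.restrictScalars_mem, Ideal.mem_span_singleton,
    toQuotient_eq_mk]
  constructor
  · rintro ⟨w, hw⟩
    obtain ⟨w, rfl⟩ := AdjoinRoot.mk_surjective w
    rw [← map_mul, AdjoinRoot.mk_eq_mk] at hw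
    exact (dvd_sub_left (dvd_mul_right g w)).1 (hg.trans hw)
  · exact fun h => map_dvd _ h

variable (F) in
theorem monic_X_pow_sub_one (hn : 0 < n) : (X ^ n - 1 : F[X]).Monic := by
  simpa using monic_X_pow_sub_C (1 : F) hn.ne'

variable (F) in
theorem degree_X_pow_sub_one (hn : 0 < n) : (X ^ n - 1 : F[X]).degree = n := by
  simpa using degree_X_pow_sub_C hn (1 : F)

variable (F) in
theorem natDegree_X_pow_sub_one : (X ^ n - 1 : F[X]).natDegree = n := by
  simpa using natDegree_X_pow_sub_C (n := n) (r := (1 : F))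

variable (n) in
/-- The word of the remainder of a polynomial modulo `x^n - 1`. -/
def toWord (f : F[X]) : Fin n → F := fun i => (f %ₘ (X ^ n - 1)).coeff i

theorem toPoly_toWord (hn : 0 < n) (f : F[X]) : toPoly (toWord n f) = f %ₘ (X ^ n - 1) :=
  toPoly_coeff ((degree_modByMonic_lt f (monic_X_pow_sub_one F hn)).trans_eq
    (degree_X_pow_sub_one F hn))

theorem toWord_toPoly (hn : 0 < n) (c : Fin n → F) : toWord n (toPoly c) = c := by
  ext i
  rw [toWord, (modByMonic_eq_self_iff (monic_X_pow_sub_one F hn)).2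
    ((degree_toPoly_lt c).trans_eq (degree_X_pow_sub_one F hn).symm), coeff_toPoly_fin]

theorem toWord_add (f g : F[X]) : toWord n (f + g) = toWord n f + toWord n g := by
  ext i
  simp [toWord, add_modByMonic]

theorem toWord_smul (k : F) (f : F[X]) : toWord n (k • f) = k • toWord n f := by
  ext i
  simp [toWord, smul_modByMonic]

theorem toWord_eq_of_dvd_sub (hn : 0 < n) {f g : F[X]} (h : X ^ n - 1 ∣ f - g) :
    toWord n f = toWord n g := by
  ext i
  rw [toWord, toWord, modByMonic_eq_of_dvd_sub (monic_X_pow_sub_one F hn) h]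

theorem dvd_sub_toPoly_toWord (hn : 0 < n) (f : F[X]) :
    X ^ n - 1 ∣ f - toPoly (toWord n f) := by
  rw [toPoly_toWord hn]
  exact ⟨f /ₘ (X ^ n - 1), by linear_combination -modByMonic_add_div f (X ^ n - 1 : F[X])⟩

theorem dvd_toPoly_toWord (hn : 0 < n) {g : F[X]} (hg : g ∣ X ^ n - 1) {f : F[X]} :
    g ∣ toPoly (toWord n f) ↔ g ∣ f :=
  (dvd_iff_dvd_of_dvd_sub (hg.trans (dvd_sub_toPoly_toWord hn f))).symm

theorem cyclicCode_le_cyclicCode_iff (hn : 0 < n) {g g' : F[X]} (hg : g ∣ X ^ n - 1)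
    (hg' : g' ∣ X ^ n - 1) : cyclicCode n g' ≤ cyclicCode n g ↔ g ∣ g' := by
  constructor
  · intro h
    have h1 : toWord n g' ∈ cyclicCode n g' := by
      rw [mem_cyclicCode hg', dvd_toPoly_toWord hn hg']
    have h2 := h h1
    rwa [mem_cyclicCode hg, dvd_toPoly_toWord hn hg] at h2
  · intro h c hc
    rw [mem_cyclicCode hg'] at hc
    exact (mem_cyclicCode hg).2 (h.trans hc)

theorem cyclicCode_inj (hn : 0 < n) {g g' : F[X]} (hg : g ∣ X ^ n - 1) (hg' : g' ∣ X ^ n - 1)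
    (hm : g.Monic) (hm' : g'.Monic) (h : cyclicCode n g = cyclicCode n g') : g = g' :=
  eq_of_monic_of_associated hm hm' (associated_of_dvd_dvd
    ((cyclicCode_le_cyclicCode_iff hn hg hg').1 h.ge)
    ((cyclicCode_le_cyclicCode_iff hn hg' hg).1 h.le))

theorem finrank_cyclicCode (hn : 0 < n) {g : F[X]} (hg : g ∣ X ^ n - 1) :
    Module.finrank F (cyclicCode n g) = n - g.natDegree := by
  have hg0 : g ≠ 0 := ne_zero_of_dvd_ne_zero (monic_X_pow_sub_one F hn).ne_zero hg
  let φ : (Fin n → F) →ₗ[F] AdjoinRoot g :=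
    { toFun := fun c => AdjoinRoot.mk g (toPoly c)
      map_add' := fun c d => by rw [toPoly_add, map_add]
      map_smul' := fun k c => by
        rw [toPoly_smul, RingHom.id_apply, AdjoinRoot.smul_mk] }
  have hker : LinearMap.ker φ = cyclicCode n g := by
    ext c
    rw [LinearMap.mem_ker, mem_cyclicCode hg]
    exact AdjoinRoot.mk_eq_zero
  have hsurj : Function.Surjective φ := by
    intro x
    obtain ⟨f, rfl⟩ := AdjoinRoot.mk_surjective x
    refine ⟨toWord n f, (AdjoinRoot.mk_eq_mk.2 ?_).symm⟩
    exact hg.trans (dvd_sub_toPoly_toWord hn f)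
  have h1 := LinearMap.finrank_range_add_finrank_ker φ
  rw [LinearMap.range_eq_top.2 hsurj, finrank_top, hker, Module.finrank_fin_fun,
    (AdjoinRoot.powerBasis hg0).finrank, AdjoinRoot.powerBasis_dim] at h1
  omega

/-! The cyclic shift -/

theorem X_mul_toPoly_sub (c : Fin n → F) :
    X ^ n - 1 ∣ X * toPoly c - toPoly (c ∘ (finRotate n).symm) := by
  cases n with
  | zero => simp [toPoly]
  | succ k =>
    have h : toPoly (c ∘ (finRotate (k + 1)).symm) =
        ∑ i, monomial (finRotate (k + 1) i : ℕ) (c i) := by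
      rw [toPoly, ← Equiv.sum_comp (finRotate (k + 1))]
      simp
    rw [h, toPoly, Finset.mul_sum, Fin.sum_univ_castSucc, Fin.sum_univ_castSucc, finRotate_last]
    have h' : ∀ i : Fin k, (finRotate (k + 1) i.castSucc : ℕ) = i + 1 := fun i => by
      rw [coe_finRotate_of_ne_last (Fin.castSucc_lt_last i).ne, Fin.val_castSucc]
    simp only [h', X_mul_monomial, Fin.val_castSucc, Fin.val_last, Fin.val_zero]
    refine ⟨C (c (Fin.last k)), ?_⟩
    rw [add_sub_add_left_eq_sub, ← C_mul_X_pow_eq_monomial, monomial_zero_left]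
    ring

theorem isCyclicCode_cyclicCode {g : F[X]} (hg : g ∣ X ^ n - 1) :
    IsCyclicCode (cyclicCode n g) := by
  intro c hc
  rw [mem_cyclicCode hg] at hc ⊢
  exact (dvd_iff_dvd_of_dvd_sub (hg.trans (X_mul_toPoly_sub c))).1 (hc.mul_left X)

theorem IsCyclicCode.exists_eq_cyclicCode (hn : 0 < n) {C : Submodule F (Fin n → F)}
    (hC : IsCyclicCode C) : ∃ g : F[X], g.Monic ∧ g ∣ X ^ n - 1 ∧ C = cyclicCode n g := by
  classical
  have hX : ∀ f : F[X], toWord n f ∈ C → toWord n (X * f) ∈ C := by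
    intro f hf
    have h1 := hC _ hf
    rw [← toWord_toPoly hn (toWord n f ∘ _), ← toWord_eq_of_dvd_sub hn (X_mul_toPoly_sub _)] at h1
    rwa [toWord_eq_of_dvd_sub hn (g := X * toPoly (toWord n f))]
    rw [← mul_sub]
    exact (dvd_sub_toPoly_toWord hn f).mul_left X
  let I : Ideal F[X] :=
    { carrier := {f | toWord n f ∈ C}
      add_mem' := fun {f g} hf hg => by
        change toWord n (f + g) ∈ C
        rw [toWord_add]
        exact C.add_mem hf hg
      zero_mem' := by
        change toWord n 0 ∈ C
        have : toWord n (0 : F[X]) = 0 := by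
          ext i
          simp [toWord]
        rw [this]
        exact C.zero_mem
      smul_mem' := fun p f hf => by
        change toWord n (p * f) ∈ C
        induction p using Polynomial.induction_on' with
        | add p q hp hq =>
          rw [add_mul, toWord_add]
          exact C.add_mem hp hq
        | monomial k a =>
          rw [← C_mul_X_pow_eq_monomial, mul_assoc, ← smul_eq_C_mul, toWord_smul]
          refine C.smul_mem a ?_
          induction k with
          | zero => simpa using hf
          | succ k ih =>
            rw [pow_succ', mul_assoc]
            exact hX _ ih }
  have hI : ∀ f, f ∈ I ↔ toWord n f ∈ C := fun f => Iff.rfl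
  have hmem : (X ^ n - 1 : F[X]) ∈ I := by
    rw [hI, toWord_eq_of_dvd_sub hn (g := 0) (by simp), ← hI]
    exact I.zero_mem
  obtain ⟨g, hg⟩ := (IsPrincipalIdealRing.principal I).principal
  change I = Ideal.span {g} at hg
  have hg0 : g ≠ 0 := by
    rintro rfl
    rw [hg, Ideal.mem_span_singleton, zero_dvd_iff] at hmem
    exact (monic_X_pow_sub_one F hn).ne_zero hmem
  have hass := associated_normalize g
  have hI' : ∀ f, f ∈ I ↔ normalize g ∣ f := fun f => by
    rw [hg, Ideal.mem_span_singleton, hass.dvd_iff_dvd_left]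
  refine ⟨normalize g, monic_normalize hg0, (hI' _).1 hmem, ?_⟩
  ext c
  rw [mem_cyclicCode ((hI' _).1 hmem), ← hI', hI, toWord_toPoly hn]

/-! The dual of a cyclic code -/

theorem reverse_X_pow_sub_one : (X ^ n - 1 : F[X]).reverse = -(X ^ n - 1) := by
  rw [reverse, natDegree_X_pow_sub_one, reflect_sub, ← C_1, reflect_C, C_1, one_mul,
    neg_sub]
  congr 1
  simp

theorem dotProduct_eq_coeff (c d : Fin n → F) :
    c ⬝ᵥ d = (toPoly c * reflect (n - 1) (toPoly d)).coeff (n - 1) := by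
  cases n with
  | zero => simp [toPoly]
  | succ k =>
    rw [coeff_mul, Finset.Nat.sum_antidiagonal_eq_sum_range_succ_mk, dotProduct,
      Finset.sum_range]
    refine Finset.sum_congr rfl fun i _ => ?_
    have hi : (i : ℕ) ≤ k := by omega
    simp only [Nat.add_sub_cancel]
    rw [coeff_toPoly_fin, coeff_reflect, revAt_le (by omega), Nat.sub_sub_self hi,
      coeff_toPoly_fin]

theorem coeff_mul_X_pow_sub_one_eq_zero {w : F[X]} (hn : 0 < n)
    (hw : ((X ^ n - 1) * w).natDegree ≤ (n - 1) + (n - 1)) :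
    ((X ^ n - 1) * w).coeff (n - 1) = 0 := by
  rcases eq_or_ne w 0 with rfl | h0
  · simp
  rw [natDegree_mul (monic_X_pow_sub_one F hn).ne_zero h0, natDegree_X_pow_sub_one] at hw
  rw [sub_mul, one_mul, coeff_sub, coeff_X_pow_mul', if_neg (by omega),
    coeff_eq_zero_of_natDegree_lt (by omega), sub_zero]

theorem ne_zero_of_dvd_X_pow_sub_one (hn : 0 < n) {g : F[X]} (hg : g ∣ X ^ n - 1) : g ≠ 0 :=
  ne_zero_of_dvd_ne_zero (monic_X_pow_sub_one F hn).ne_zero hg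

theorem natDegree_reverse_of_dvd (hn : 0 < n) {g : F[X]} (hg : g ∣ X ^ n - 1) :
    g.reverse.natDegree = g.natDegree := by
  rw [reverse_natDegree, natTrailingDegree_eq_zero.2, Nat.sub_zero]
  right
  intro h0
  obtain ⟨w, hw⟩ := hg
  have := congrArg (fun f => f.coeff 0) hw
  simp [mul_coeff_zero, h0, hn.ne, coeff_X_pow] at this

theorem dualCode_cyclicCode (hn : 0 < n) {g h : F[X]} (hgh : g * h = X ^ n - 1) :
    dualCode (cyclicCode n g) = cyclicCode n h.reverse := by
  have hg : g ∣ X ^ n - 1 := ⟨h, hgh.symm⟩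
  have hh : h ∣ X ^ n - 1 := ⟨g, by rw [← hgh, mul_comm]⟩
  have hrev : g.reverse * h.reverse = -(X ^ n - 1) := by
    rw [← reverse_mul_of_domain, hgh, reverse_X_pow_sub_one]
  have hhr : h.reverse ∣ X ^ n - 1 := by
    rw [← dvd_neg, ← hrev]
    exact dvd_mul_left _ _
  symm
  refine Submodule.eq_of_le_of_finrank_eq ?_ ?_
  · intro c hc d hd
    rw [mem_cyclicCode hhr] at hc
    rw [mem_cyclicCode hg] at hd
    obtain ⟨u, hu⟩ := hc
    obtain ⟨w, hw⟩ := hd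
    have hdvd : X ^ n - 1 ∣ toPoly c * reflect (n - 1) (toPoly d) := by
      rcases eq_or_ne w 0 with rfl | hw0
      · simp [hw]
      have hdeg := natDegree_toPoly_le d
      rw [hw, natDegree_mul (ne_zero_of_dvd_X_pow_sub_one hn hg) hw0] at hdeg
      have : reflect (n - 1) (toPoly d) =
          g.reverse * reflect (n - 1 - g.natDegree) w := by
        rw [reverse, ← reflect_mul g w le_rfl (by omega), hw]
        congr 1
        omega
      rw [this, hu, ← neg_dvd, ← hrev]
      exact ⟨u * reflect (n - 1 - g.natDegree) w, by ring⟩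
    rw [dotProduct_eq_coeff]
    have hdeg : (toPoly c * reflect (n - 1) (toPoly d)).natDegree ≤ (n - 1) + (n - 1) := by
      refine natDegree_mul_le.trans (add_le_add (natDegree_toPoly_le c) ?_)
      exact natDegree_reflect_le.trans (max_le le_rfl (natDegree_toPoly_le d))
    obtain ⟨v, hv⟩ := hdvd
    rw [hv] at hdeg ⊢
    exact coeff_mul_X_pow_sub_one_eq_zero hn hdeg
  · rw [finrank_dualCode, finrank_cyclicCode hn hg, finrank_cyclicCode hn hhr,
      natDegree_reverse_of_dvd hn hh]
    have := congrArg natDegree hgh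
    rw [natDegree_mul (ne_zero_of_dvd_X_pow_sub_one hn hg) (ne_zero_of_dvd_X_pow_sub_one hn hh),
      natDegree_X_pow_sub_one] at this
    omega

theorem dualCode_cyclicCode_le_iff (hn : 0 < n) {g : F[X]} (hg : g ∣ X ^ n - 1) :
    dualCode (cyclicCode n g) ≤ cyclicCode n g ↔ g * g.reverse ∣ X ^ n - 1 := by
  obtain ⟨h, hgh⟩ := hg
  have hrev : g.reverse * h.reverse = -(X ^ n - 1) := by
    rw [← reverse_mul_of_domain, ← hgh, reverse_X_pow_sub_one]
  have hhr : h.reverse ∣ X ^ n - 1 := by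
    rw [← dvd_neg, ← hrev]
    exact dvd_mul_left _ _
  have hg0 : g.reverse ≠ 0 := by
    rw [Ne, reverse_eq_zero]
    exact ne_zero_of_dvd_X_pow_sub_one hn ⟨h, hgh⟩
  rw [dualCode_cyclicCode hn hgh.symm, cyclicCode_le_cyclicCode_iff hn ⟨h, hgh⟩ hhr,
    ← dvd_neg (a := g * g.reverse), ← hrev, mul_comm g, mul_dvd_mul_iff_left hg0]

end CyclicCode

section Factorization

variable {F : Type*} [Field F] {ι : Type*} [Fintype ι] {P : ι → F[X]}

theorem prod_pow_dvd_prod_pow_iff (hirr : ∀ x, Irreducible (P x)) (hmon : ∀ x, (P x).Monic)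
    (hinj : Function.Injective P) {e f : ι → ℕ} :
    ∏ x, P x ^ e x ∣ ∏ x, P x ^ f x ↔ e ≤ f := by
  classical
  constructor
  · intro h x
    have h1 : P x ^ e x ∣ P x ^ f x * ∏ y ∈ Finset.univ.erase x, P y ^ f y := by
      rw [Finset.mul_prod_erase _ (fun y => P y ^ f y) (Finset.mem_univ x)]
      exact (Finset.dvd_prod_of_mem (fun y => P y ^ e y) (Finset.mem_univ x)).trans h
    have h2 : IsCoprime (P x ^ e x) (∏ y ∈ Finset.univ.erase x, P y ^ f y) := by
      refine IsCoprime.prod_right fun y hy => IsCoprime.pow ?_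
      refine (hirr x).coprime_iff_not_dvd.2 fun hd => ?_
      exact (Finset.ne_of_mem_erase hy) (hinj (eq_of_monic_of_associated (hmon x) (hmon y)
        ((hirr x).associated_of_dvd (hirr y) hd))).symm
    exact (pow_dvd_pow_iff (hirr x).ne_zero (hirr x).not_isUnit).1 (h2.dvd_of_dvd_mul_right h1)
  · exact fun h => Finset.prod_dvd_prod_of_dvd _ _ fun x _ => pow_dvd_pow _ (h x)

theorem exists_eq_prod_pow_of_dvd (hirr : ∀ x, Irreducible (P x)) (hmon : ∀ x, (P x).Monic)
    {g : F[X]} (hg : g.Monic) {f : ι → ℕ} (h : g ∣ ∏ x, P x ^ f x) :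
    ∃ e : ι → ℕ, g = ∏ x, P x ^ e x := by
  classical
  suffices H : ∀ (S : Finset ι) (g : F[X]), g ∣ ∏ x ∈ S, P x ^ f x →
      ∃ e : ι → ℕ, Associated g (∏ x ∈ S, P x ^ e x) by
    obtain ⟨e, he⟩ := H _ g h
    exact ⟨e, eq_of_monic_of_associated hg (monic_prod_of_monic _ _ fun x _ => (hmon x).pow _) he⟩
  intro S
  induction S using Finset.induction_on with
  | empty =>
    intro g hg
    exact ⟨0, by simpa using isUnit_of_dvd_one hg⟩
  | insert x S hx ih =>
    intro g hg
    rw [Finset.prod_insert hx] at hg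
    obtain ⟨g₁, g₂, h₁, h₂, rfl⟩ := exists_dvd_and_dvd_of_dvd_mul hg
    obtain ⟨e, he⟩ := ih g₂ h₂
    obtain ⟨k, -, hk⟩ := (dvd_prime_pow (hirr x).prime _).1 h₁
    refine ⟨Function.update e x k, ?_⟩
    rw [Finset.prod_insert hx, Function.update_self]
    refine hk.mul_mul ?_
    rwa [Finset.prod_congr rfl fun y hy => by
      rw [Function.update_of_ne (ne_of_mem_of_not_mem hy hx)]]

theorem natDegree_prod_pow (hmon : ∀ x, (P x).Monic) (e : ι → ℕ) :
    (∏ x, P x ^ e x).natDegree = ∑ x, e x * (P x).natDegree := by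
  rw [natDegree_prod_of_monic _ _ fun x _ => (hmon x).pow _]
  exact Finset.sum_congr rfl fun x _ => natDegree_pow _ _

theorem reverse_prod_pow_associated {σ : ι → ι} (hσ : Function.Involutive σ)
    (hrev : ∀ x, Associated (P x).reverse (P (σ x))) (e : ι → ℕ) :
    Associated (∏ x, P x ^ e x).reverse (∏ x, P x ^ e (σ x)) := by
  let R : F[X] →* F[X] :=
    { toFun := reverse
      map_one' := by rw [← C_1, reverse_C]
      map_mul' := reverse_mul_of_domain }
  have h1 : (∏ x, P x ^ e x).reverse = ∏ x, (P x).reverse ^ e x := by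
    change R _ = ∏ x, R (P x) ^ e x
    simp only [map_prod, map_pow]
  rw [h1, ← Equiv.prod_comp (Function.Involutive.toPerm σ hσ)]
  refine Associated.prod _ _ _ fun x _ => ?_
  have := (hrev (σ x)).pow_pow (n := e (σ x))
  rwa [hσ x] at this

variable {n M : ℕ} {σ : ι → ι}

theorem dualCode_cyclicCode_prod_pow_le_iff (hn : 0 < n) (hirr : ∀ x, Irreducible (P x))
    (hmon : ∀ x, (P x).Monic) (hinj : Function.Injective P)
    (hprod : ∏ x, P x ^ M = X ^ n - 1) (hσ : Function.Involutive σ)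
    (hrev : ∀ x, Associated (P x).reverse (P (σ x))) {e : ι → ℕ}
    (he : ∏ x, P x ^ e x ∣ X ^ n - 1) :
    dualCode (cyclicCode n (∏ x, P x ^ e x)) ≤ cyclicCode n (∏ x, P x ^ e x) ↔
      ∀ x, e x + e (σ x) ≤ M := by
  rw [dualCode_cyclicCode_le_iff hn he,
    ((Associated.refl _).mul_mul (reverse_prod_pow_associated hσ hrev e)).dvd_iff_dvd_left,
    ← Finset.prod_mul_distrib, ← hprod]
  simp only [← pow_add]
  exact prod_pow_dvd_prod_pow_iff hirr hmon hinj

theorem prod_pow_dvd_X_pow_sub_one (hprod : ∏ x, P x ^ M = X ^ n - 1) {e : ι → ℕ}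
    (he : ∀ x, e x ≤ M) : ∏ x, P x ^ e x ∣ X ^ n - 1 := by
  rw [← hprod]
  exact Finset.prod_dvd_prod_of_dvd _ _ fun x _ => pow_dvd_pow _ (he x)

theorem ncard_cyclicCSSCodes [Fintype F] (hn : 0 < n) (hirr : ∀ x, Irreducible (P x))
    (hmon : ∀ x, (P x).Monic) (hinj : Function.Injective P)
    (hprod : ∏ x, P x ^ M = X ^ n - 1) (hσ : Function.Involutive σ)
    (hrev : ∀ x, Associated (P x).reverse (P (σ x))) :
    (cyclicCSSCodes F n).ncard = {e : ι → ℕ | ∀ x, e x + e (σ x) ≤ M}.ncard := by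
  let code : (ι → ℕ) → Submodule F (Fin n → F) := fun e => cyclicCode n (∏ x, P x ^ e x)
  have hdvd : ∀ e : ι → ℕ, (∀ x, e x + e (σ x) ≤ M) → ∏ x, P x ^ e x ∣ X ^ n - 1 := fun e he =>
    prod_pow_dvd_X_pow_sub_one hprod fun x => (Nat.le_add_right _ _).trans (he x)
  have himage : cyclicCSSCodes F n =
      (fun e => cssCode (code e) (dualCode (code e))) '' {e | ∀ x, e x + e (σ x) ≤ M} := by
    ext Q
    constructor
    · rintro ⟨C, hC, hd, rfl⟩
      obtain ⟨g, hg, hgd, rfl⟩ := hC.exists_eq_cyclicCode hn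
      obtain ⟨e, rfl⟩ := exists_eq_prod_pow_of_dvd hirr hmon hg (f := fun _ => M)
        (by rwa [hprod])
      exact ⟨e, (dualCode_cyclicCode_prod_pow_le_iff hn hirr hmon hinj hprod hσ hrev hgd).1 hd,
        rfl⟩
    · rintro ⟨e, he, rfl⟩
      exact ⟨code e, isCyclicCode_cyclicCode (hdvd e he),
        (dualCode_cyclicCode_prod_pow_le_iff hn hirr hmon hinj hprod hσ hrev (hdvd e he)).2 he,
        rfl⟩
  rw [himage]
  refine Set.InjOn.ncard_image fun e he f hf hef => ?_
  have h1 : code e = code f := cssCode_dualCode_injOn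
    ((dualCode_cyclicCode_prod_pow_le_iff hn hirr hmon hinj hprod hσ hrev (hdvd e he)).2 he)
    ((dualCode_cyclicCode_prod_pow_le_iff hn hirr hmon hinj hprod hσ hrev (hdvd f hf)).2 hf) hef
  have hm : ∀ e : ι → ℕ, (∏ x, P x ^ e x).Monic := fun e =>
    monic_prod_of_monic _ _ fun x _ => (hmon x).pow _
  have h2 := cyclicCode_inj hn (hdvd e he) (hdvd f hf) (hm e) (hm f) h1
  exact le_antisymm ((prod_pow_dvd_prod_pow_iff hirr hmon hinj).1 h2.dvd)
    ((prod_pow_dvd_prod_pow_iff hirr hmon hinj).1 h2.symm.dvd)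

end Factorization

section Counting

theorem card_pairs_add_le (M : ℕ) :
    2 * Nat.card {u : ℕ × ℕ // u.1 + u.2 ≤ M} = (M + 1) * (M + 2) := by
  have h : {u : ℕ × ℕ | u.1 + u.2 ≤ M} =
      ((Finset.range (M + 1)).biUnion Finset.HasAntidiagonal.antidiagonal : Finset (ℕ × ℕ)) := by
    ext u
    simp
  change 2 * Set.ncard {u : ℕ × ℕ | u.1 + u.2 ≤ M} = _
  rw [h, Set.ncard_coe_finset, Finset.card_biUnion]
  · simp only [Finset.Nat.card_antidiagonal]
    clear h
    induction M with
    | zero => rfl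
    | succ M ih =>
      rw [Finset.sum_range_succ, mul_add, ih]
      ring
  · intro i _ k _ hik
    rw [Function.onFun, Finset.disjoint_left]
    intro u hu hu'
    rw [Finset.HasAntidiagonal.mem_antidiagonal] at hu hu'
    exact hik (hu.symm.trans hu')

theorem card_two_mul_le {M : ℕ} (hM : Odd M) :
    Nat.card {u : ℕ // u + u ≤ M} = (M + 1) / 2 := by
  have h : {u : ℕ | u + u ≤ M} = (Finset.range ((M + 1) / 2) : Finset ℕ) := by
    obtain ⟨k, rfl⟩ := hM
    ext u
    simp only [Set.mem_ofPred_eq, Finset.coe_range, Set.mem_Iio]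
    omega
  change Set.ncard {u : ℕ | u + u ≤ M} = _
  rw [h, Set.ncard_coe_finset, Finset.card_range]

variable (L : Type*)

/-- The involution with exactly the two fixed points `inl b` that swaps `inr (l, false)` and
`inr (l, true)`. -/
def swapPairs : Bool ⊕ L × Bool → Bool ⊕ L × Bool :=
  Sum.map id (Prod.map id not)

theorem swapPairs_involutive : Function.Involutive (swapPairs L) := by
  rintro (b | ⟨l, b⟩) <;> simp [swapPairs]

/-- Exponent functions with bounded sums along `swapPairs`, split into their values at the fixed
points and at the pairs. -/
def exponentsEquiv (M : ℕ) :
    {e : Bool ⊕ L × Bool → ℕ // ∀ x, e x + e (swapPairs L x) ≤ M} ≃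
      (Bool → {u : ℕ // u + u ≤ M}) × (L → {u : ℕ × ℕ // u.1 + u.2 ≤ M}) where
  toFun e := (fun b => ⟨e.1 (.inl b), e.2 (.inl b)⟩,
    fun l => ⟨(e.1 (.inr (l, false)), e.1 (.inr (l, true))), e.2 (.inr (l, false))⟩)
  invFun f := ⟨Sum.elim (fun b => f.1 b) (fun x => if x.2 then (f.2 x.1).1.2 else (f.2 x.1).1.1),
    by
      rintro (b | ⟨l, b⟩)
      · exact (f.1 b).2
      · cases b
        · exact (f.2 l).2
        · exact (add_comm _ _).trans_le (f.2 l).2⟩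
  left_inv e := by
    ext x
    rcases x with b | ⟨l, b⟩
    · rfl
    · cases b <;> rfl
  right_inv f := rfl

theorem ncard_exponents [Fintype L] {M : ℕ} (hM : Odd M) :
    {e : Bool ⊕ L × Bool → ℕ | ∀ x, e x + e (swapPairs L x) ≤ M}.ncard =
      (M + 2) ^ Fintype.card L * ((M + 1) / 2) ^ (Fintype.card L + 2) := by
  have hpairs : Nat.card {u : ℕ × ℕ // u.1 + u.2 ≤ M} = (M + 2) * ((M + 1) / 2) := by
    have := card_pairs_add_le M
    obtain ⟨k, rfl⟩ := hM
    have h2 : (2 * k + 1 + 1) / 2 = k + 1 := by omega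
    rw [h2]
    linarith
  change Nat.card {e : Bool ⊕ L × Bool → ℕ // ∀ x, e x + e (swapPairs L x) ≤ M} = _
  rw [Nat.card_congr (exponentsEquiv L M), Nat.card_prod, Nat.card_fun, Nat.card_fun,
    card_two_mul_le hM, hpairs, Nat.card_eq_fintype_card (α := Bool), Fintype.card_bool,
    Nat.card_eq_fintype_card (α := L), mul_pow, pow_add]
  ring

end Counting

section TwoPowers

theorem exists_pow_two_pow_eq {a b : ℕ} (ha : 2 ≤ a) (hb : Odd b) (k : ℕ) :
    ∃ c, Odd c ∧ (2 ^ a * b + 1) ^ 2 ^ k = 2 ^ (a + k) * c + 1 := by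
  induction k with
  | zero => exact ⟨b, hb, by simp⟩
  | succ k ih =>
    obtain ⟨c, hc, h⟩ := ih
    obtain ⟨d, rfl⟩ : ∃ d, a = d + 2 := ⟨a - 2, by omega⟩
    refine ⟨2 * (2 ^ (d + k) * c ^ 2) + c, (even_two_mul _).add_odd hc, ?_⟩
    rw [pow_succ 2 k, pow_mul, h]
    ring

theorem orderOf_natCast_zmod_two_pow {a b : ℕ} (ha : 2 ≤ a) (hb : Odd b) (i : ℕ) :
    orderOf ((2 ^ a * b + 1 : ℕ) : ZMod (2 ^ i)) = 2 ^ (i - a) := by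
  have hz : ∀ l c : ℕ, Odd c → (((2 ^ l * c + 1 : ℕ) : ZMod (2 ^ i)) = 1 ↔ i ≤ l) := by
    intro l c hc
    rw [Nat.cast_add, Nat.cast_one, add_eq_right, ZMod.natCast_eq_zero_iff]
    constructor
    · intro h
      exact (Nat.pow_dvd_pow_iff_le_right (by norm_num)).1
        ((Nat.Coprime.pow_left i hc.coprime_two_left).dvd_of_dvd_mul_right h)
    · exact fun h => (pow_dvd_pow 2 h).mul_right c
  rcases le_or_gt i a with h | h
  · rw [(hz a b hb).2 h, orderOf_one, Nat.sub_eq_zero_of_le h, pow_zero]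
  · obtain ⟨k, rfl⟩ : ∃ k, i = a + (k + 1) := ⟨i - a - 1, by omega⟩
    rw [Nat.add_sub_cancel_left]
    refine orderOf_eq_prime_pow ?_ ?_
    · obtain ⟨c, hc, h⟩ := exists_pow_two_pow_eq ha hb k
      rw [← Nat.cast_pow, h, hz _ _ hc]
      omega
    · obtain ⟨c, hc, h⟩ := exists_pow_two_pow_eq ha hb (k + 1)
      rw [← Nat.cast_pow, h, hz _ _ hc]

theorem two_pow_dvd_of_three_pow_eq_one {c d : ℕ} (hc : 2 ≤ c)
    (h : (3 : ZMod (2 ^ c)) ^ d = 1) : 2 ^ (c - 2) ∣ d := by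
  have hd : Even d := by
    by_contra hodd
    rw [Nat.not_even_iff_odd] at hodd
    have h4 : (3 : ZMod 4) ^ d = 1 := by
      have := congrArg (ZMod.castHom (pow_dvd_pow 2 hc) (ZMod (2 ^ 2))) h
      rwa [map_pow, map_ofNat, map_one] at this
    obtain ⟨e, rfl⟩ := hodd
    rw [pow_add, pow_mul] at h4
    have h9 : (3 : ZMod 4) ^ 2 = 1 := by decide
    rw [h9, one_pow] at h4
    exact absurd h4 (by decide)
  obtain ⟨e, rfl⟩ := hd
  rw [← two_mul] at h ⊢
  rcases hc.eq_or_lt with rfl | hc'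
  · simp
  have h9 : ((2 ^ 3 * 1 + 1 : ℕ) : ZMod (2 ^ c)) ^ e = 1 := by
    rw [← h, pow_mul]
    norm_num
  have h1 := orderOf_dvd_of_pow_eq_one h9
  rw [orderOf_natCast_zmod_two_pow (by norm_num) odd_one] at h1
  obtain ⟨k, rfl⟩ : ∃ k, c = k + 3 := ⟨c - 3, by omega⟩
  have : k + 3 - 2 = k + 1 := by omega
  rw [this, pow_succ']
  exact mul_dvd_mul_left 2 (by simpa using h1)

theorem three_pow_inj {c k l : ℕ} (hc : 2 ≤ c) (hk : k < 2 ^ (c - 2)) (hl : l < 2 ^ (c - 2))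
    (h : (3 : ZMod (2 ^ c)) ^ k = 3 ^ l) : k = l := by
  wlog hkl : k ≤ l generalizing k l
  · exact (this hl hk h.symm (by omega)).symm
  obtain ⟨d, rfl⟩ := Nat.exists_eq_add_of_le hkl
  have hu : IsUnit (3 : ZMod (2 ^ c)) := by
    have := (ZMod.isUnit_iff_coprime 3 (2 ^ c)).2 (Nat.Coprime.pow_right _ (by norm_num))
    simpa using this
  have h1 : (3 : ZMod (2 ^ c)) ^ d = 1 := by
    rw [pow_add] at h
    exact (hu.pow k).mul_left_cancel (by rw [← h, mul_one])
  have h2 := two_pow_dvd_of_three_pow_eq_one hc h1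
  have h3 := Nat.eq_zero_of_dvd_of_lt h2 (by omega)
  omega

theorem three_pow_ne_neg {c k l : ℕ} (hc : 2 ≤ c) (hk : k < 2 ^ (c - 2))
    (hl : l < 2 ^ (c - 2)) : (3 : ZMod (2 ^ c)) ^ k ≠ -3 ^ l := by
  intro h
  rcases hc.eq_or_lt with rfl | hc'
  · have hk0 : k = 0 := by simpa using hk
    have hl0 : l = 0 := by simpa using hl
    subst hk0 hl0
    exact absurd h (by decide)
  · have h8 : (3 : ZMod 8) ^ k = -3 ^ l := by
      have := congrArg (ZMod.castHom (pow_dvd_pow 2 hc') (ZMod (2 ^ 3))) h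
      rwa [map_neg, map_pow, map_pow, map_ofNat] at this
    have hpow : ∀ m : ℕ, (3 : ZMod 8) ^ m = 1 ∨ (3 : ZMod 8) ^ m = 3 := by
      intro m
      induction m with
      | zero => simp
      | succ m ih =>
        rcases ih with ih | ih <;> rw [pow_succ, ih]
        · simp
        · left
          decide
    rcases hpow k with h1 | h1 <;> rcases hpow l with h2 | h2 <;> rw [h1, h2] at h8 <;>
      exact absurd h8 (by decide)

end TwoPowers

section MinimalPolynomials

variable {F : Type*} [Field F] {K : Type*} [Field K] [Algebra F K]

theorem isIntegral_of_isPrimitiveRoot {ξ : K} {N : ℕ} (hN : 0 < N) (h : IsPrimitiveRoot ξ N) :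
    IsIntegral F ξ :=
  ⟨X ^ N - 1, monic_X_pow_sub_one F hN, by simp [h.pow_eq_one]⟩

theorem minpoly_dvd_X_pow_sub_one {ξ : K} {N : ℕ} (h : ξ ^ N = 1) :
    minpoly F ξ ∣ X ^ N - 1 :=
  minpoly.dvd F ξ (by simp [h])

theorem reverse_minpoly_associated {ξ : K} (h0 : ξ ≠ 0) (hξ : IsIntegral F ξ) :
    Associated (minpoly F ξ).reverse (minpoly F ξ⁻¹) := by
  have key : ∀ {ξ : K}, ξ ≠ 0 → minpoly F ξ⁻¹ ∣ (minpoly F ξ).reverse := by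
    intro ξ h0
    let := invertibleOfNonzero h0
    refine minpoly.dvd F _ ?_
    have := (eval₂_reverse_eq_zero_iff (algebraMap F K) ξ (minpoly F ξ)).2 (minpoly.aeval F ξ)
    rwa [invOf_eq_inv] at this
  have hi : IsIntegral F ξ⁻¹ := hξ.inv
  have h1 := natDegree_le_of_dvd (key h0)
    (by rw [Ne, reverse_eq_zero]; exact minpoly.ne_zero hξ)
  have h2 := natDegree_le_of_dvd (key (inv_ne_zero h0))
    (by rw [Ne, reverse_eq_zero]; exact minpoly.ne_zero hi)
  rw [inv_inv] at h2
  refine (associated_of_dvd_of_natDegree_le (key h0) ?_ ?_).symm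
  · rw [Ne, reverse_eq_zero]
    exact minpoly.ne_zero hξ
  · exact (reverse_natDegree_le _).trans (h2.trans (reverse_natDegree_le _))

variable [Fintype F] {a b : ℕ}

theorem natDegree_minpoly_of_isPrimitiveRoot (ha : 2 ≤ a) (hb : Odd b)
    (hq : Fintype.card F = 2 ^ a * b + 1) {ξ : K} {i : ℕ} (hξ : IsPrimitiveRoot ξ (2 ^ i)) :
    (minpoly F ξ).natDegree = 2 ^ (i - a) := by
  obtain ⟨p, hp⟩ := CharP.exists F
  obtain ⟨f, hpp, hf⟩ := FiniteField.card F p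
  have : Fact p.Prime := ⟨hpp⟩
  have hodd : Odd p := by
    refine (Nat.odd_pow_iff f.ne_zero).1 ?_
    rw [← hf, hq]
    exact (((even_two.pow_of_ne_zero (by omega)).mul_right b)).add_one
  have hcop : p.Coprime (2 ^ i) := Nat.Coprime.pow_right i hodd.coprime_two_right
  have hdvd : minpoly F ξ ∣ cyclotomic (2 ^ i) F := by
    refine minpoly.dvd F ξ ?_
    have := hξ.isRoot_cyclotomic (by positivity)
    rwa [aeval_def, ← eval_map, map_cyclotomic]
  rw [natDegree_of_dvd_cyclotomic_of_irreducible hf hcop hdvd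
    (minpoly.irreducible (isIntegral_of_isPrimitiveRoot (by positivity) hξ)), ← orderOf_units,
    ZMod.coe_unitOfCoprime, ← hf, hq, orderOf_natCast_zmod_two_pow ha hb]

theorem pow_eq_pow_of_minpoly_eq (ha : 2 ≤ a) (hb : Odd b)
    (hq : Fintype.card F = 2 ^ a * b + 1) {ξ ξ' : K} {i : ℕ} (hξ : IsPrimitiveRoot ξ (2 ^ i))
    (h : minpoly F ξ = minpoly F ξ') : ξ ^ 2 ^ (i - a) = ξ' ^ 2 ^ (i - a) := by
  have h1 : IsPrimitiveRoot (ξ ^ 2 ^ (i - a)) (2 ^ (i - (i - a))) :=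
    hξ.pow (by positivity) (by rw [← pow_add]; congr 1; omega)
  have h2 := natDegree_minpoly_of_isPrimitiveRoot (F := F) ha hb hq h1
  rw [Nat.sub_eq_zero_of_le (show i - (i - a) ≤ a by omega), pow_zero,
    minpoly.natDegree_eq_one_iff] at h2
  obtain ⟨c, hc⟩ := h2
  have h3 : minpoly F ξ' ∣ X ^ 2 ^ (i - a) - C c := by
    rw [← h]
    exact minpoly.dvd F ξ (by simp [hc])
  have h4 := aeval_eq_zero_of_dvd_aeval_eq_zero h3 (minpoly.aeval F ξ')
  rw [map_sub, map_pow, aeval_X, aeval_C, hc, sub_eq_zero] at h4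
  exact h4.symm

omit [Fintype F] in
theorem level_eq_of_minpoly_eq {ξ ξ' : K} {i i' : ℕ} (hξ : IsPrimitiveRoot ξ (2 ^ i))
    (hξ' : IsPrimitiveRoot ξ' (2 ^ i')) (h : minpoly F ξ = minpoly F ξ') : i = i' := by
  have key : ∀ {ξ ξ' : K} {N : ℕ}, minpoly F ξ = minpoly F ξ' → ξ ^ N = 1 → ξ' ^ N = 1 := by
    intro ξ ξ' N h hN
    have h1 := minpoly_dvd_X_pow_sub_one (F := F) hN
    rw [h] at h1
    have h2 := aeval_eq_zero_of_dvd_aeval_eq_zero h1 (minpoly.aeval F ξ')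
    simpa [sub_eq_zero] using h2
  have h1 := hξ'.dvd_of_pow_eq_one _ (key h hξ.pow_eq_one)
  have h2 := hξ.dvd_of_pow_eq_one _ (key h.symm hξ'.pow_eq_one)
  exact Nat.pow_right_injective le_rfl (Nat.dvd_antisymm h2 h1)

end MinimalPolynomials

section IndexSet

/-- Half of the number of elements of `D a i`. -/
def halfCard (a i : ℕ) : ℕ := if i ≤ a then 2 ^ (i - 2) else 2 ^ (a - 2)

theorem halfCard_eq (a i : ℕ) : halfCard a i = 2 ^ (min i a - 2) := by
  unfold halfCard
  split_ifs with h
  · rw [min_eq_left h]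
  · rw [min_eq_right (by omega)]

@[to_additive]
theorem prod_D {A : Type*} [CommMonoid A] (a i : ℕ) (f : ℤ → A) :
    ∏ t ∈ D a i, f t = ∏ k ∈ Finset.range (halfCard a i), f (3 ^ k) * f (-3 ^ k) := by
  unfold D
  rw [Finset.prod_union, Finset.prod_image, Finset.prod_image, Finset.prod_image,
    ← Finset.prod_mul_distrib]
  · rfl
  · exact fun k _ l _ h => Int.pow_right_injective (by norm_num) h
  · exact fun x _ y _ h => neg_injective h
  · exact fun k _ l _ h => Int.pow_right_injective (by norm_num) h
  · rw [Finset.disjoint_left]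
    intro x hx hx'
    simp only [Finset.mem_image] at hx hx'
    obtain ⟨k, -, rfl⟩ := hx
    obtain ⟨_, ⟨l, -, rfl⟩, h⟩ := hx'
    have h1 : (0 : ℤ) < 3 ^ k := by positivity
    have h2 : (0 : ℤ) < 3 ^ l := by positivity
    omega

theorem three_pow_mem_D {a i k : ℕ} (hk : k < halfCard a i) : (3 : ℤ) ^ k ∈ D a i := by
  refine Finset.mem_union_left _ (Finset.mem_image_of_mem _ (Finset.mem_range.2 hk))

/-- The pairs `(i, k)` such that `3 ^ k ∈ D a i` and `2 ≤ i ≤ r`. -/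
def pairIndex (a r : ℕ) : Finset (Σ _ : ℕ, ℕ) :=
  (Finset.Icc 2 r).sigma fun i => Finset.range (halfCard a i)

theorem mem_pairIndex {a r : ℕ} {l : Σ _ : ℕ, ℕ} :
    l ∈ pairIndex a r ↔ (2 ≤ l.1 ∧ l.1 ≤ r) ∧ l.2 < halfCard a l.1 := by
  simp [pairIndex]

theorem sum_halfCard {a : ℕ} (ha : 2 ≤ a) (r : ℕ) (hr : 1 ≤ r) :
    ∑ i ∈ Finset.Icc 2 r, halfCard a i * 2 ^ (i - a) = 2 ^ (r - 1) - 1 := by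
  induction r, hr using Nat.le_induction with
  | base => rfl
  | succ r hr ih =>
    rw [Finset.sum_Icc_succ_top (by omega), ih, halfCard_eq, ← pow_add]
    have h1 : min (r + 1) a - 2 + (r + 1 - a) = r - 1 := by omega
    have h2 : 2 ^ (r + 1 - 1) = 2 * 2 ^ (r - 1) := by
      rw [← pow_succ']
      congr 1
      omega
    have h3 : 0 < 2 ^ (r - 1) := by positivity
    rw [h1, h2]
    omega

theorem card_pairIndex_of_le {a r : ℕ} (ha : 2 ≤ a) (hr : 1 ≤ r) (h : r ≤ a) :
    (pairIndex a r).card = 2 ^ (r - 1) - 1 := by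
  rw [pairIndex, Finset.card_sigma, ← sum_halfCard ha r hr]
  refine Finset.sum_congr rfl fun i hi => ?_
  rw [Finset.card_range, Nat.sub_eq_zero_of_le ((Finset.mem_Icc.1 hi).2.trans h), pow_zero,
    mul_one]

theorem card_pairIndex_of_lt {a r : ℕ} (ha : 2 ≤ a) (h : a ≤ r) :
    (pairIndex a r).card = 2 ^ (a - 1) + (r - a) * 2 ^ (a - 2) - 1 := by
  induction r, h using Nat.le_induction with
  | base => simp [card_pairIndex_of_le ha (by omega) le_rfl]
  | succ r hr ih =>
    rw [pairIndex, Finset.card_sigma] at ih ⊢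
    rw [Finset.sum_Icc_succ_top (by omega), ih, Finset.card_range, halfCard, if_neg (by omega),
      Nat.succ_sub hr, Nat.succ_mul]
    have h3 : 0 < 2 ^ (a - 1) := by positivity
    generalize (r - a) * 2 ^ (a - 2) = x
    generalize 2 ^ (a - 1) = y at h3 ⊢
    generalize 2 ^ (a - 2) = z
    omega

/-- The exponents `h` of the distinct minimal polynomials `m_h`. -/
def rootExp (a r : ℕ) : Bool ⊕ pairIndex a r × Bool → ℤ
  | .inl false => 0
  | .inl true => 2 ^ (r - 1)
  | .inr (l, false) => 3 ^ l.1.2 * 2 ^ (r - l.1.1)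
  | .inr (l, true) => -3 ^ l.1.2 * 2 ^ (r - l.1.1)

/-- The base-two logarithm of the order of `β ^ h`, `h` the value of `rootExp`. -/
def level (a r : ℕ) : Bool ⊕ pairIndex a r × Bool → ℕ
  | .inl false => 0
  | .inl true => 1
  | .inr (l, _) => l.1.1

theorem level_swapPairs (a r : ℕ) (x : Bool ⊕ pairIndex a r × Bool) :
    level a r (swapPairs _ x) = level a r x := by
  rcases x with b | ⟨l, b⟩ <;> rfl

@[to_additive]
theorem prod_pairIndex {A : Type*} [CommMonoid A] (a r : ℕ)
    (f : Bool ⊕ pairIndex a r × Bool → A) (g₁ g₂ : ℕ → ℕ → A)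
    (h₁ : ∀ l, f (.inr (l, false)) = g₁ l.1.1 l.1.2)
    (h₂ : ∀ l, f (.inr (l, true)) = g₂ l.1.1 l.1.2) :
    ∏ x, f x = f (.inl false) * f (.inl true) *
      ∏ i ∈ Finset.Icc 2 r, ∏ k ∈ Finset.range (halfCard a i), g₁ i k * g₂ i k := by
  rw [Fintype.prod_sum_type, Fintype.prod_bool, Fintype.prod_prod_type, mul_comm (f (.inl true))]
  simp only [Fintype.prod_bool, h₁, h₂]
  rw [Finset.prod_sigma', Finset.univ_eq_attach,
    Finset.prod_attach (pairIndex a r) fun l => g₂ l.1 l.2 * g₁ l.1 l.2]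
  congr 1
  exact Finset.prod_congr rfl fun l _ => mul_comm (g₂ l.1 l.2) (g₁ l.1 l.2)

end IndexSet

section Factors

variable {F : Type*} [Field F] {K : Type*} [Field K] [Algebra F K] {a b r : ℕ} {β : K}

variable (F) in
theorem generator_eq_prod (β : K) (a r : ℕ) (j : ℤ → ℕ) :
    generator F β a r j = ∏ x, m F β (rootExp a r x) ^ j (rootExp a r x) := by
  rw [prod_pairIndex a r _
    (fun i k => m F β (3 ^ k * 2 ^ (r - i)) ^ j (3 ^ k * 2 ^ (r - i)))
    (fun i k => m F β (-3 ^ k * 2 ^ (r - i)) ^ j (-3 ^ k * 2 ^ (r - i)))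
    (fun _ => rfl) (fun _ => rfl), generator]
  simp only [prod_D]
  rfl

theorem isPrimitiveRoot_zpow_rootExp (hr : 1 ≤ r) (hβ : IsPrimitiveRoot β (2 ^ r))
    (x : Bool ⊕ pairIndex a r × Bool) :
    IsPrimitiveRoot (β ^ rootExp a r x) (2 ^ level a r x) := by
  have hpow : ∀ i ≤ r, IsPrimitiveRoot (β ^ 2 ^ (r - i)) (2 ^ i) := fun i hi =>
    hβ.pow (by positivity) (by rw [← pow_add]; congr 1; omega)
  have hodd : ∀ i ≤ r, ∀ t : ℤ, Odd t → IsPrimitiveRoot (β ^ (t * 2 ^ (r - i))) (2 ^ i) := by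
    intro i hi t ht
    have := (hpow i hi).zpow_of_gcd_eq_one t (by
      have h2 : IsCoprime t (2 ^ i) := IsCoprime.pow_right (by
        obtain ⟨k, rfl⟩ := ht
        exact ⟨1, -k, by ring⟩)
      exact_mod_cast Int.isCoprime_iff_gcd_eq_one.1 h2)
    rw [← zpow_natCast, ← zpow_mul] at this
    have hcomm : t * 2 ^ (r - i) = ((2 ^ (r - i) : ℕ) : ℤ) * t := by
      push_cast
      exact mul_comm _ _
    rwa [hcomm]
  have h3 : ∀ k : ℕ, Odd ((3 : ℤ) ^ k) := fun k => Odd.pow (by decide)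
  match x with
  | .inl false =>
    change IsPrimitiveRoot (β ^ (0 : ℤ)) (2 ^ 0)
    simp
  | .inl true =>
    have := hodd 1 hr 1 odd_one
    rwa [one_mul] at this
  | .inr (l, false) => exact hodd _ (mem_pairIndex.1 l.2).1.2 _ (h3 _)
  | .inr (l, true) => exact hodd _ (mem_pairIndex.1 l.2).1.2 _ (h3 _).neg

theorem zpow_rootExp_swapPairs (hr : 1 ≤ r) (hβ : IsPrimitiveRoot β (2 ^ r))
    (x : Bool ⊕ pairIndex a r × Bool) :
    β ^ rootExp a r (swapPairs _ x) = (β ^ rootExp a r x)⁻¹ := by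
  rw [← zpow_neg]
  match x with
  | .inl false => rfl
  | .inl true =>
    have h := (isPrimitiveRoot_zpow_rootExp (a := a) hr hβ (.inl true)).pow_eq_one
    change (β ^ ((2 : ℤ) ^ (r - 1))) ^ 2 = 1 at h
    change β ^ ((2 : ℤ) ^ (r - 1)) = β ^ (-(2 : ℤ) ^ (r - 1))
    rw [zpow_neg]
    exact eq_inv_of_mul_eq_one_left (by rw [← pow_two, h])
  | .inr (l, false) =>
    change β ^ (-3 ^ l.1.2 * 2 ^ (r - l.1.1) : ℤ) = β ^ (-(3 ^ l.1.2 * 2 ^ (r - l.1.1)) : ℤ)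
    rw [neg_mul]
  | .inr (l, true) =>
    change β ^ (3 ^ l.1.2 * 2 ^ (r - l.1.1) : ℤ) = β ^ (-(-3 ^ l.1.2 * 2 ^ (r - l.1.1)) : ℤ)
    rw [neg_mul, neg_neg]

theorem isIntegral_zpow_rootExp (hr : 1 ≤ r) (hβ : IsPrimitiveRoot β (2 ^ r))
    (x : Bool ⊕ pairIndex a r × Bool) : IsIntegral F (β ^ rootExp a r x) :=
  isIntegral_of_isPrimitiveRoot (by positivity) (isPrimitiveRoot_zpow_rootExp hr hβ x)

theorem irreducible_m_rootExp (hr : 1 ≤ r) (hβ : IsPrimitiveRoot β (2 ^ r))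
    (x : Bool ⊕ pairIndex a r × Bool) : Irreducible (m F β (rootExp a r x)) :=
  minpoly.irreducible (isIntegral_zpow_rootExp hr hβ x)

theorem monic_m_rootExp (hr : 1 ≤ r) (hβ : IsPrimitiveRoot β (2 ^ r))
    (x : Bool ⊕ pairIndex a r × Bool) : (m F β (rootExp a r x)).Monic :=
  minpoly.monic (isIntegral_zpow_rootExp hr hβ x)

theorem reverse_m_rootExp_associated (hr : 1 ≤ r) (hβ : IsPrimitiveRoot β (2 ^ r))
    (x : Bool ⊕ pairIndex a r × Bool) :
    Associated (m F β (rootExp a r x)).reverse (m F β (rootExp a r (swapPairs _ x))) := by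
  rw [m, m, zpow_rootExp_swapPairs hr hβ]
  exact reverse_minpoly_associated (zpow_ne_zero _ (hβ.ne_zero (by positivity)))
    (isIntegral_zpow_rootExp hr hβ x)

variable [Fintype F]

theorem natDegree_m_rootExp (ha : 2 ≤ a) (hb : Odd b) (hq : Fintype.card F = 2 ^ a * b + 1)
    (hr : 1 ≤ r) (hβ : IsPrimitiveRoot β (2 ^ r)) (x : Bool ⊕ pairIndex a r × Bool) :
    (m F β (rootExp a r x)).natDegree = 2 ^ (level a r x - a) :=
  natDegree_minpoly_of_isPrimitiveRoot ha hb hq (isPrimitiveRoot_zpow_rootExp hr hβ x)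

/-- A minimal polynomial at level `i` determines the unit `t` modulo `2 ^ min i a`. -/
theorem intCast_eq_of_m_eq (ha : 2 ≤ a) (hb : Odd b) (hq : Fintype.card F = 2 ^ a * b + 1)
    (hβ : IsPrimitiveRoot β (2 ^ r)) {i : ℕ} (hi : i ≤ r) {t t' : ℤ}
    (ht : IsPrimitiveRoot (β ^ (t * 2 ^ (r - i))) (2 ^ i))
    (h : m F β (t * 2 ^ (r - i)) = m F β (t' * 2 ^ (r - i))) :
    (t : ZMod (2 ^ min i a)) = t' := by
  have h1 := pow_eq_pow_of_minpoly_eq (F := F) ha hb hq ht h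
  have hβ0 : β ≠ 0 := hβ.ne_zero (by positivity)
  rw [← zpow_natCast, ← zpow_natCast, ← zpow_mul, ← zpow_mul, ← mul_inv_eq_one₀
    (zpow_ne_zero _ hβ0), ← zpow_neg, ← zpow_add₀ hβ0, hβ.zpow_eq_one_iff_dvd] at h1
  rw [eq_comm, ZMod.intCast_eq_intCast_iff_dvd_sub]
  have hr : (2 ^ r : ℤ) = 2 ^ min i a * (2 ^ (r - i) * 2 ^ (i - a)) := by
    rw [← pow_add, ← pow_add]
    congr 1
    omega
  push_cast at h1 ⊢
  rw [hr] at h1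
  refine (mul_dvd_mul_iff_right (c := (2 ^ (r - i) * 2 ^ (i - a) : ℤ)) (by positivity)).1 ?_
  have e : (t - t') * (2 ^ (r - i) * 2 ^ (i - a)) =
      t * 2 ^ (r - i) * 2 ^ (i - a) + -(t' * 2 ^ (r - i) * 2 ^ (i - a)) := by ring
  rwa [e]

theorem m_rootExp_injective (ha : 2 ≤ a) (hb : Odd b) (hq : Fintype.card F = 2 ^ a * b + 1)
    (hr : 1 ≤ r) (hβ : IsPrimitiveRoot β (2 ^ r)) :
    Function.Injective fun x => m F β (rootExp a r x) := by
  intro x y h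
  have hprim := fun x => isPrimitiveRoot_zpow_rootExp (a := a) hr hβ x
  have hlev : level a r x = level a r y := level_eq_of_minpoly_eq (hprim x) (hprim y) h
  have hpair : ∀ (l l' : pairIndex a r), l.1.1 = l'.1.1 → l.1.2 = l'.1.2 → l = l' := by
    rintro ⟨⟨i, k⟩, hl⟩ ⟨⟨i', k'⟩, hl'⟩ h1 h2
    simp only at h1 h2
    subst h1 h2
    rfl
  rcases x with b | ⟨l, b⟩ <;> rcases y with b' | ⟨l', b'⟩
  · cases b <;> cases b' <;> simp [level] at hlev ⊢
  · have := (mem_pairIndex.1 l'.2).1.1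
    cases b <;> simp only [level] at hlev <;> omega
  · have := (mem_pairIndex.1 l.2).1.1
    cases b' <;> simp only [level] at hlev <;> omega
  · simp only [level] at hlev
    obtain ⟨⟨hi, hir⟩, hk⟩ := mem_pairIndex.1 l.2
    obtain ⟨-, hk'⟩ := mem_pairIndex.1 l'.2
    rw [← hlev] at hk'
    rw [halfCard_eq] at hk hk'
    have hc : 2 ≤ min l.1.1 a := le_min hi ha
    have hx := hprim (.inr (l, b))
    cases b <;> cases b' <;> simp only [rootExp, level] at h hx <;> rw [← hlev] at h <;>
      have h1 := intCast_eq_of_m_eq ha hb hq hβ hir hx h <;> push_cast at h1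
    · rw [hpair l l' hlev (three_pow_inj hc hk hk' h1)]
    · exact absurd h1 (three_pow_ne_neg hc hk hk')
    · exact absurd h1.symm (three_pow_ne_neg hc hk' hk)
    · rw [hpair l l' hlev (three_pow_inj hc hk hk' (neg_injective h1))]

theorem prod_m_rootExp (ha : 2 ≤ a) (hb : Odd b) (hq : Fintype.card F = 2 ^ a * b + 1)
    (hr : 1 ≤ r) (hβ : IsPrimitiveRoot β (2 ^ r)) :
    ∏ x, m F β (rootExp a r x) = X ^ 2 ^ r - 1 := by
  have hirr := irreducible_m_rootExp (F := F) (a := a) hr hβ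
  have hmon := monic_m_rootExp (F := F) (a := a) hr hβ
  have hinj := m_rootExp_injective (F := F) ha hb hq hr hβ
  have hdvd : ∏ x, m F β (rootExp a r x) ∣ X ^ 2 ^ r - 1 := by
    refine Finset.prod_dvd_of_coprime (fun x _ y _ hxy => ?_) fun x _ => ?_
    · refine (hirr x).coprime_iff_not_dvd.2 fun hd => hxy (hinj ?_)
      exact eq_of_monic_of_associated (hmon x) (hmon y) ((hirr x).associated_of_dvd (hirr y) hd)
    · refine minpoly_dvd_X_pow_sub_one ?_
      rw [← zpow_natCast, ← zpow_mul, mul_comm, zpow_mul, zpow_natCast, hβ.pow_eq_one, one_zpow]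
  refine (eq_of_monic_of_dvd_of_natDegree_le (monic_prod_of_monic _ _ fun x _ => hmon x)
    (monic_X_pow_sub_one F (by positivity)) hdvd ?_).symm
  rw [natDegree_X_pow_sub_one, natDegree_prod_of_monic _ _ fun x _ => hmon x]
  simp only [natDegree_m_rootExp ha hb hq hr hβ]
  rw [sum_pairIndex a r _ (fun i _ => 2 ^ (i - a)) (fun i _ => 2 ^ (i - a)) (fun _ => rfl)
    (fun _ => rfl)]
  simp only [level, Finset.sum_const, Finset.card_range, smul_eq_mul, mul_add]
  rw [Finset.sum_add_distrib, sum_halfCard ha r hr, Nat.sub_eq_zero_of_le (by omega : 0 ≤ a),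
    Nat.sub_eq_zero_of_le (by omega : 1 ≤ a), pow_zero]
  have h2 : 2 ^ r = 2 * 2 ^ (r - 1) := by
    rw [← pow_succ']
    congr 1
    omega
  have h3 : 0 < 2 ^ (r - 1) := by positivity
  omega

end Factors

section MainTheorem

variable {p : ℕ} [Fact p.Prime] {F : Type*} [Field F] [Fintype F] [Algebra (ZMod p) F]
  {K : Type*} [Field K] [Algebra F K] {a b r s : ℕ} {β : K}

theorem odd_of_card_eq (ha : 2 ≤ a) (hq : Fintype.card F = 2 ^ a * b + 1) : Odd p := by
  rw [Module.card_eq_pow_finrank (K := ZMod p), ZMod.card] at hq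
  refine Nat.Odd.of_mul_left (n := p ^ (Module.finrank (ZMod p) F - 1)) ?_
  rw [← pow_succ', Nat.sub_add_cancel Module.finrank_pos, hq]
  exact ((even_two.pow_of_ne_zero (by omega)).mul_right b).add_one

theorem prod_m_rootExp_pow (ha : 2 ≤ a) (hb : Odd b) (hq : Fintype.card F = 2 ^ a * b + 1)
    (hr : 1 ≤ r) (hβ : IsPrimitiveRoot β (2 ^ r)) :
    ∏ x, m F β (rootExp a r x) ^ p ^ s = X ^ (2 ^ r * p ^ s) - 1 := by
  have := charP_of_injective_algebraMap (algebraMap (ZMod p) F).injective p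
  rw [Finset.prod_pow, prod_m_rootExp ha hb hq hr hβ, sub_pow_char_pow, one_pow, ← pow_mul]

variable {j : ℤ → ℕ}

omit [Fact p.Prime] in
theorem exponents_add_le (hj₀ : 2 * j 0 < p ^ s) (hj₁ : 2 * j (2 ^ (r - 1)) < p ^ s)
    (hj : ∀ i, 2 ≤ i → i ≤ r → ∀ t ∈ D a i,
      j (t * 2 ^ (r - i)) + j (-t * 2 ^ (r - i)) ≤ p ^ s) (x : Bool ⊕ pairIndex a r × Bool) :
    j (rootExp a r x) + j (rootExp a r (swapPairs _ x)) ≤ p ^ s := by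
  match x with
  | .inl false =>
    change j 0 + j 0 ≤ p ^ s
    omega
  | .inl true =>
    change j (2 ^ (r - 1)) + j (2 ^ (r - 1)) ≤ p ^ s
    omega
  | .inr (l, false) =>
    obtain ⟨⟨hi, hir⟩, hk⟩ := mem_pairIndex.1 l.2
    exact hj _ hi hir _ (three_pow_mem_D hk)
  | .inr (l, true) =>
    obtain ⟨⟨hi, hir⟩, hk⟩ := mem_pairIndex.1 l.2
    rw [add_comm]
    exact hj _ hi hir _ (three_pow_mem_D hk)

theorem natDegree_generator (ha : 2 ≤ a) (hb : Odd b) (hq : Fintype.card F = 2 ^ a * b + 1)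
    (hr : 1 ≤ r) (hβ : IsPrimitiveRoot β (2 ^ r)) :
    (generator F β a r j).natDegree =
      ∑ x, j (rootExp a r x) * 2 ^ (level a r x - a) := by
  rw [generator_eq_prod,
    natDegree_prod_pow (monic_m_rootExp hr hβ)]
  exact Finset.sum_congr rfl fun x _ => by rw [natDegree_m_rootExp ha hb hq hr hβ]

theorem sum_rootExp_eq (ha : 2 ≤ a) :
    ∑ x, j (rootExp a r x) * 2 ^ (level a r x - a) = j 0 + j (2 ^ (r - 1)) +
      ∑ i ∈ Finset.Icc 2 r, ∑ t ∈ D a i, j (t * 2 ^ (r - i)) * 2 ^ (i - a) := by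
  rw [sum_pairIndex a r _ (fun i k => j (3 ^ k * 2 ^ (r - i)) * 2 ^ (i - a))
    (fun i k => j (-3 ^ k * 2 ^ (r - i)) * 2 ^ (i - a)) (fun _ => rfl) (fun _ => rfl)]
  simp only [sum_D]
  congr 1
  simp [rootExp, level, Nat.sub_eq_zero_of_le (show 1 ≤ a by omega)]

theorem two_mul_natDegree_generator_lt (ha : 2 ≤ a) (hb : Odd b)
    (hq : Fintype.card F = 2 ^ a * b + 1) (hr : 1 ≤ r) (hβ : IsPrimitiveRoot β (2 ^ r))
    (hj₀ : 2 * j 0 < p ^ s)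
    (hj : ∀ x, j (rootExp a r x) + j (rootExp a r (swapPairs _ x)) ≤ p ^ s) :
    2 * (generator F β a r j).natDegree < 2 ^ r * p ^ s := by
  have hdeg := congrArg natDegree (prod_m_rootExp_pow (p := p) (s := s) (F := F) ha hb hq hr hβ)
  rw [natDegree_X_pow_sub_one,
    natDegree_prod_pow (monic_m_rootExp hr hβ)] at hdeg
  simp only [natDegree_m_rootExp ha hb hq hr hβ] at hdeg
  have hswap : ∑ x, j (rootExp a r x) * 2 ^ (level a r x - a) =
      ∑ x, j (rootExp a r (swapPairs _ x)) * 2 ^ (level a r x - a) := by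
    rw [← Equiv.sum_comp (Function.Involutive.toPerm _ (swapPairs_involutive (pairIndex a r)))]
    refine Finset.sum_congr rfl fun x _ => ?_
    rw [Function.Involutive.coe_toPerm, level_swapPairs]
  rw [← hdeg, natDegree_generator ha hb hq hr hβ, two_mul]
  nth_rewrite 2 [hswap]
  rw [← Finset.sum_add_distrib]
  simp only [← add_mul]
  refine Finset.sum_lt_sum (fun x _ => Nat.mul_le_mul_right _ (hj x))
    ⟨.inl false, Finset.mem_univ _, Nat.mul_lt_mul_of_pos_right ?_ (by positivity)⟩
  change j 0 + j 0 < p ^ s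
  omega

end MainTheorem

end QuantumCyclic

end

theorem theorem9 {p : ℕ} [Fact p.Prime]
    {F : Type*} [Field F] [Fintype F] [DecidableEq F] [Algebra (ZMod p) F]
    {K : Type*} [Field K] [Algebra F K]
    (a b r s : ℕ) (ha : 2 ≤ a) (hb : Odd b) (hr : 1 ≤ r) (hs : 1 ≤ s)
    (hq : Fintype.card F = 2 ^ a * b + 1)
    (β : K) (hβ : IsPrimitiveRoot β (2 ^ r))
    (j : ℤ → ℕ)
    (hj₀ : 2 * j 0 < p ^ s) (hj₁ : 2 * j (2 ^ (r - 1)) < p ^ s)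
    (hj : ∀ i, 2 ≤ i → i ≤ r → ∀ t ∈ QuantumCyclic.D a i,
      j (t * 2 ^ (r - i)) + j (-t * 2 ^ (r - i)) ≤ p ^ s)
    (C : Submodule F (Fin (2 ^ r * p ^ s) → F))
    (hC : C = QuantumCyclic.cyclicCode (2 ^ r * p ^ s)
      (QuantumCyclic.generator F β a r j)) :
    QuantumCyclic.IsCyclicCode C ∧
    QuantumCyclic.dualCode C ≤ C ∧
    (r ≤ a →
      QuantumCyclic.IsQECCode p (QuantumCyclic.cssCode C (QuantumCyclic.dualCode C))
        ((2 ^ r * p ^ s : ℤ) - 2 * j 0 - 2 * j (2 ^ (r - 1))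
          - 2 * ∑ i ∈ Finset.Icc 2 r, ∑ t ∈ QuantumCyclic.D a i, (j (t * 2 ^ (r - i)) : ℤ))
        (QuantumCyclic.minDist C) ∧
      (QuantumCyclic.cyclicCSSCodes F (2 ^ r * p ^ s)).ncard =
        (p ^ s + 2) ^ (2 ^ (r - 1) - 1) * ((p ^ s + 1) / 2) ^ (2 ^ (r - 1) + 1)) ∧
    (a < r →
      QuantumCyclic.IsQECCode p (QuantumCyclic.cssCode C (QuantumCyclic.dualCode C))
        ((2 ^ r * p ^ s : ℤ) - 2 * j 0 - 2 * j (2 ^ (r - 1))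
          - 2 * ∑ i ∈ Finset.Icc 2 a, ∑ t ∈ QuantumCyclic.D a i, (j (t * 2 ^ (r - i)) : ℤ)
          - 2 * ∑ i ∈ Finset.Icc (a + 1) r, ∑ t ∈ QuantumCyclic.D a i,
              2 ^ (i - a) * (j (t * 2 ^ (r - i)) : ℤ))
        (QuantumCyclic.minDist C) ∧
      (QuantumCyclic.cyclicCSSCodes F (2 ^ r * p ^ s)).ncard =
        (p ^ s + 2) ^ (2 ^ (a - 1) + (r - a) * 2 ^ (a - 2) - 1) *
          ((p ^ s + 1) / 2) ^ (2 ^ (a - 1) + (r - a) * 2 ^ (a - 2) + 1)) ∧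
    ((∃ c ∈ C, c ∉ QuantumCyclic.dualCode C ∧ hammingNorm c = QuantumCyclic.minDist C) →
      QuantumCyclic.quantumMinDist p (QuantumCyclic.cssCode C (QuantumCyclic.dualCode C)) =
        QuantumCyclic.minDist C) := by
  have hp := QuantumCyclic.odd_of_card_eq (p := p) (F := F) ha hq
  have hM : Odd (p ^ s) := hp.pow
  have hn : 0 < 2 ^ r * p ^ s := Nat.mul_pos (by positivity) hM.pos
  have hirr := QuantumCyclic.irreducible_m_rootExp (F := F) (a := a) hr hβ
  have hmon := QuantumCyclic.monic_m_rootExp (F := F) (a := a) hr hβ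
  have hinj := QuantumCyclic.m_rootExp_injective (F := F) ha hb hq hr hβ
  have hprod := QuantumCyclic.prod_m_rootExp_pow (p := p) (s := s) (F := F) ha hb hq hr hβ
  have hrev := QuantumCyclic.reverse_m_rootExp_associated (F := F) (a := a) hr hβ
  have hσ := QuantumCyclic.swapPairs_involutive (QuantumCyclic.pairIndex a r)
  have he := QuantumCyclic.exponents_add_le hj₀ hj₁ hj
  have hdvd : QuantumCyclic.generator F β a r j ∣ X ^ (2 ^ r * p ^ s) - 1 := by
    rw [QuantumCyclic.generator_eq_prod]
    exact QuantumCyclic.prod_pow_dvd_X_pow_sub_one hprod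
      fun x => (Nat.le_add_right _ _).trans (he x)
  have hdual : QuantumCyclic.dualCode C ≤ C := by
    rw [QuantumCyclic.generator_eq_prod] at hC hdvd
    rw [hC]
    exact (QuantumCyclic.dualCode_cyclicCode_prod_pow_le_iff hn hirr hmon hinj hprod hσ hrev
      hdvd).2 he
  have hlt := QuantumCyclic.two_mul_natDegree_generator_lt ha hb hq hr hβ hj₀ he
  have hfin := QuantumCyclic.finrank_cyclicCode hn hdvd
  rw [← hC] at hfin
  have hqec := QuantumCyclic.isQECCode_cssCode p hdual (by omega)
  have hk : 2 * (Module.finrank F C : ℤ) - (2 ^ r * p ^ s : ℕ) = (2 ^ r * p ^ s : ℤ) - 2 * j 0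
      - 2 * j (2 ^ (r - 1)) - 2 * ∑ i ∈ Finset.Icc 2 r, ∑ t ∈ QuantumCyclic.D a i,
        2 ^ (i - a) * (j (t * 2 ^ (r - i)) : ℤ) := by
    rw [hfin, Nat.cast_sub (by omega), QuantumCyclic.natDegree_generator ha hb hq hr hβ,
      QuantumCyclic.sum_rootExp_eq ha]
    push_cast
    simp only [mul_comm (2 ^ (_ - a) : ℤ)]
    ring
  rw [hk] at hqec
  have hcount : (QuantumCyclic.cyclicCSSCodes F (2 ^ r * p ^ s)).ncard = _ :=
    (QuantumCyclic.ncard_cyclicCSSCodes hn hirr hmon hinj hprod hσ hrev).trans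
      (QuantumCyclic.ncard_exponents _ hM)
  rw [Fintype.card_coe] at hcount
  refine ⟨hC ▸ QuantumCyclic.isCyclicCode_cyclicCode hdvd, hdual, fun hra => ⟨?_, ?_⟩,
    fun har => ⟨?_, ?_⟩, QuantumCyclic.quantumMinDist_eq_minDist p hdual⟩
  · convert hqec using 5 with i hi t ht
    rw [Nat.sub_eq_zero_of_le ((Finset.mem_Icc.1 hi).2.trans hra), pow_zero, one_mul]
  · rw [hcount, QuantumCyclic.card_pairIndex_of_le ha hr hra]
    have : 0 < 2 ^ (r - 1) := by positivity
    congr 2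
    omega
  · have hsplit : Finset.Icc 2 r = Finset.Icc 2 a ∪ Finset.Icc (a + 1) r := by
      ext i
      simp only [Finset.mem_union, Finset.mem_Icc]
      omega
    have hdisj : Disjoint (Finset.Icc 2 a) (Finset.Icc (a + 1) r) := by
      rw [Finset.disjoint_left]
      intro i hi hi'
      rw [Finset.mem_Icc] at hi hi'
      omega
    rw [hsplit, Finset.sum_union hdisj, mul_add, ← sub_sub] at hqec
    convert hqec using 6 with i hi t ht
    rw [Nat.sub_eq_zero_of_le (Finset.mem_Icc.1 hi).2, pow_zero, one_mul]
  · rw [hcount, QuantumCyclic.card_pairIndex_of_lt ha har.le]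
    have : 0 < 2 ^ (a - 1) := by positivity
    congr 2
    omega
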